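/- **Setting.** A quantum system has a nonzero finite-dimensional Hilbert space $\mathcal H$, the tensor product of the Hilbert spaces of finitely many parts, together with sets of preparations $P$, measurements $M$ and transformations $T$. These are represented by density operators, self-adjoint operators and unitary operators on $\mathcal H$; each representation is onto and possibly many-to-one. $[a]_A$ denotes the projection onto the eigenspace of $A$ for $a$. For each set $J$ of parts some of the measurements are local to $J$ (only the parts in $J$ are measured). They are represented by operators $A\otimes\mathbb 1$ with $A$ acting on the space $\mathcal H_J$ of $J$, every self-adjoint $A$ on $\mathcal H_J$ occurs, a measurement local to $J$ is local to every larger set, and every measurement is local to the set of all parts. Measurements $M,N$ local to complementary sets of parts can be performed together, with pairs $(a,b)$ as outcomes. An *ontic model* of a system consists of a measurable space $\Lambda$, a probability measure $\mu_P$ on $\Lambda$ for every preparation $P$, Markov kernels $p_M(\cdot\mid\lambda)$ on the outcomes (eigenvalues) for every measurement $M$, Markov kernels $p_{M,N}(\cdot,\cdot\mid\lambda)$ on the pairs of outcomes for local measurements $M,N$ on complementary sets of parts, and a Markov kernel $\gamma_T$ from $\Lambda$ to itself for every transformation $T$, such that the averages over $\mu_P$ (also after applying $\gamma_T$) are the Born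 probabilities: $\int p_M(a\mid\lambda)\,d\mu_P=\mathrm{Tr}(\rho[a]_A)$ and $\int p_{M,N}(a,b\mid\lambda)\,d\mu_P=\mathrm{Tr}(\rho[a]_A[b]_B)$ when $P,M,N$ are represented by $\rho,A,B$, and likewise with $U\rho U^*$ in place of $\rho$ after a transformation represented by $U$. It satisfies *parameter independence* if $p_M(a\mid\lambda)=\sum_b p_{M,N}(a,b\mid\lambda)$ and $p_N(b\mid\lambda)=\sum_a p_{M,N}(a,b\mid\lambda)$ for all $\lambda,a,b$ and all such $M,N$. A *complete ontic model* consists of an ontic model for every finite-dimensional quantum system and, for all systems $S,R$ and every preparation $P_2$ of $R$, a Markov kernel $\gamma_{P_2}$ from $\Lambda_S$ to $\Lambda_{S\otimes R}$ such that for every preparation $P_1$ of $S$ the measure $\int\gamma_{P_2}(\cdot\mid\lambda)\,d\mu_{P_1}(\lambda)$ is that of a preparation of $S\otimes R$ represented by $\rho_1\otimes\rho_2$, where $\rho_1,\rho_2$ represent $P_1,P_2$. It satisfies parameter independence if all its ontic models do. It satisfies *ancilla independence* if for all $S,R$ and every measurement $M$ on $S$, represented by $A$, there is a measurement $M'$ on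 $S\otimes R$, represented by $A\otimes\mathbb 1$ and local to the same parts of $S$ as $M$, such that $p_M(a\mid\lambda)=\int p_{M'}(a\mid\tilde\lambda)\,\gamma_{P_2}(d\tilde\lambda\mid\lambda)$ for every preparation $P_2$ of $R$, every $a$ and every $\lambda\in\Lambda_S$. **Theorem 2 (Extended equiprobability theorem).** Take a complete ontic model that satisfies ancilla independence and parameter independence. Let a system be divided into two complementary sets of parts with Hilbert spaces $\mathcal H_A,\mathcal H_B$ of dimension $d\ge2$. Let $\psi\in\mathcal H_A\otimes\mathcal H_B$ be a unit vector, and let $(e_i)_{i=1}^d,(f_i)_{i=1}^d$ be orthonormal bases of $\mathcal H_A,\mathcal H_B$ and $c_i\in\mathbb C$ numbers with $\psi=\sum_{i=1}^d c_i\,e_i\otimes f_i$. Then the ontic model of the system is trivial with respect to all preparations $P$ represented by $\psi$ and all local measurements diagonal in these bases. That is, for every measurement $M$ local to the first side and represented by $A\otimes\mathbb 1$ with $A$ real diagonal in $(e_i)$, or local to the second side and represented by $\mathbb 1\otimes B$ with $B$ real diagonal in $(f_i)$, and for every outcome $a$, the probability $p_M(a\mid\lambda)$ equals its quantum mechanical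 value for $\mu_P$-almost every $\lambda$. Moreover, if such measurements $M,N$ on the two sides are both performed and at least one of $A,B$ is non-degenerate, then for all $a,b$ also $p_{M,N}(a,b\mid\lambda)$ equals its quantum mechanical value $\langle\psi,([a]_A\otimes[b]_B)\psi\rangle$ for $\mu_P$-almost every $\lambda$. -/

import Mathlib

open MeasureTheory ProbabilityTheory
open scoped Matrix ComplexOrder

universe u v

noncomputable section

namespace Ontic

/-! ## Finite-dimensional quantum systems and their parts -/

/-- A finite-dimensional quantum system, given by finitely many (separable) parts with nonzero
finite-dimensional Hilbert spaces. Its Hilbert space is the tensor product of the spaces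
`ℂ ^ (dim i)`, i.e. `EuclideanSpace ℂ Idx`, where `Idx` is the set of the product basis vectors. The
parts record which tensor factorisations of the Hilbert space are factorisations into subsystems;
a single system of dimension `n` has one part, a pair of such systems has two. -/
structure QSys where
  parts : Type
  [fintypeParts : Fintype parts]
  [decEqParts : DecidableEq parts]
  dim : parts → ℕ
  dim_pos : ∀ i, 0 < dim i

attribute [instance] QSys.fintypeParts QSys.decEqParts

/-- Labels of the product basis of the Hilbert space of the system. -/
abbrev QSys.Idx (S : QSys) : Type := ∀ i, Fin (S.dim i)

/-- Labels of the product basis of the Hilbert space of the subsystem with parts in `J`. -/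
abbrev QSys.SubIdx (S : QSys) (J : Finset S.parts) : Type := ∀ i : J, Fin (S.dim i)

/-- Operators on the Hilbert space of the system. -/
abbrev QSys.Op (S : QSys) : Type := Matrix S.Idx S.Idx ℂ

/-- Restriction of a label to a subsystem. -/
def QSys.res (S : QSys) (J : Finset S.parts) (x : S.Idx) : S.SubIdx J := fun i => x i

/-- The operator `A ⊗ 𝟙`, where `A` acts on the subsystem `J` and `𝟙` on the remaining parts. -/
def QSys.embed (S : QSys) (J : Finset S.parts)
    (A : Matrix (S.SubIdx J) (S.SubIdx J) ℂ) : S.Op :=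
  Matrix.of fun x y => if ∀ i, i ∉ J → x i = y i then A (S.res J x) (S.res J y) else 0

/-- The product vector `u ⊗ v`, where `u` is a vector of the subsystem `J` and `v` one of the
complementary subsystem. -/
def QSys.prodVec (S : QSys) (J : Finset S.parts)
    (u : EuclideanSpace ℂ (S.SubIdx J)) (v : EuclideanSpace ℂ (S.SubIdx Jᶜ)) :
    EuclideanSpace ℂ S.Idx :=
  WithLp.toLp 2 fun x => u (S.res J x) * v (S.res Jᶜ x)

/-- The joint system, with Hilbert space `H_S ⊗ H_R`. -/
abbrev QSys.prod (S R : QSys) : QSys where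
  parts := S.parts ⊕ R.parts
  dim := Sum.elim S.dim R.dim
  dim_pos := by
    rintro (i | i)
    · exact S.dim_pos i
    · exact R.dim_pos i

/-- The operator `A ⊗ B` on the Hilbert space of the joint system. -/
def QSys.prodOp {S R : QSys} (A : S.Op) (B : R.Op) : (S.prod R).Op :=
  Matrix.of fun x y =>
    A (fun i => x (Sum.inl i)) (fun i => y (Sum.inl i)) *
      B (fun i => x (Sum.inr i)) (fun i => y (Sum.inr i))

/-! ## Density operators, spectral projections, the Born rule -/

section Matrices

variable {n : Type} [Fintype n] [DecidableEq n]

/-- Density operators. -/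
def IsDensity (ρ : Matrix n n ℂ) : Prop := ρ.PosSemidef ∧ ρ.trace = 1

/-- The density operator `[ψ]` of a (unit) vector `ψ`. -/
def pureState (ψ : EuclideanSpace ℂ n) : Matrix n n ℂ :=
  Matrix.vecMulVec (fun x => ψ x) (fun x => star (ψ x))

/-- The possible outcomes of a measurement represented by `A`: its (real) eigenvalues. -/
def outcomes (A : Matrix n n ℂ) : Set ℝ :=
  {a | Module.End.HasEigenvalue (Matrix.toEuclideanLin A) (a : ℂ)}

/-- The orthogonal projection `[a]_A` onto the eigenspace of `A` for `a`
(zero if `a` is not an eigenvalue). -/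
def eigProj (A : Matrix n n ℂ) (a : ℝ) : Matrix n n ℂ :=
  Matrix.toEuclideanLin.symm
    (Module.End.eigenspace (Matrix.toEuclideanLin A) (a : ℂ)).starProjection.toLinearMap

/-- The Born rule `Tr(ρ A)`, for `A` a projection. -/
def born (ρ A : Matrix n n ℂ) : ℝ := (ρ * A).trace.re

/-- The operator `∑ i, a i • [e i]`, diagonal in the orthonormal basis `e`. -/
def diagOp {d : ℕ} (e : OrthonormalBasis (Fin d) ℂ (EuclideanSpace ℂ n)) (a : Fin d → ℝ) :
    Matrix n n ℂ :=
  ∑ i, (a i : ℂ) • pureState (e i)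

end Matrices

/-! ## Operational procedures and ontic models -/

/-- The preparations, measurements and transformations of a quantum system, and the quantum
mechanical operators that represent them. The representation is onto and may be many-to-one.
`loc J` is the set of the measurements that are performed locally on the parts in `J` only. -/
structure Procedures (S : QSys) where
  Prep : Type u
  Meas : Type u
  Trans : Type u
  state : Prep → S.Op
  op : Meas → S.Op
  unitary : Trans → Matrix.unitaryGroup S.Idx ℂ
  state_density : ∀ P, IsDensity (state P)
  state_surj : ∀ ρ, IsDensity ρ → ∃ P, state P = ρ
  op_herm : ∀ M, (op M).IsHermitian
  op_surj : ∀ A : S.Op, A.IsHermitian → ∃ M, op M = A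
  unitary_surj : Function.Surjective unitary
  loc : Finset S.parts → Set Meas
  loc_op : ∀ J, ∀ M ∈ loc J,
    ∃ A : Matrix (S.SubIdx J) (S.SubIdx J) ℂ, A.IsHermitian ∧ op M = S.embed J A
  loc_surj : ∀ J, ∀ A : Matrix (S.SubIdx J) (S.SubIdx J) ℂ, A.IsHermitian →
    ∃ M ∈ loc J, op M = S.embed J A
  loc_mono : ∀ J K, J ⊆ K → loc J ⊆ loc K
  loc_univ : ∀ M, M ∈ loc Finset.univ

/-- `M` and `N` can be performed together as a local measurement on a pair: `M` is performed on
the parts in some `J` and `N` on the parts outside of `J`. -/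
def Procedures.SepLocal {S : QSys} (Q : Procedures S) (M N : Q.Meas) : Prop :=
  ∃ J : Finset S.parts, M ∈ Q.loc J ∧ N ∈ Q.loc Jᶜ

/-- An ontic model of a quantum system. `resp M l {a}` is the probability of the outcome `a` in the
measurement `M` given the ontic state `l`, and `joint M N l {(a, b)}` the one of the pair of outcomes
`(a, b)` if the local measurements `M` and `N` on complementary subsystems are both
performed (the value of `joint` at all other pairs has no meaning and is not constrained).
On average the quantum mechanical predictions are reproduced. -/
structure OnticModel {S : QSys} (Q : Procedures.{u} S) where
  Λ : Type v
  [measurableSpaceΛ : MeasurableSpace Λ]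
  μ : Q.Prep → Measure Λ
  resp : Q.Meas → Kernel Λ ℝ
  joint : Q.Meas → Q.Meas → Kernel Λ (ℝ × ℝ)
  trans : Q.Trans → Kernel Λ Λ
  μ_prob : ∀ P, IsProbabilityMeasure (μ P)
  resp_markov : ∀ M, IsMarkovKernel (resp M)
  resp_outcomes : ∀ M l, resp M l (outcomes (Q.op M))ᶜ = 0
  joint_markov : ∀ M N, Q.SepLocal M N → IsMarkovKernel (joint M N)
  joint_outcomes : ∀ M N, Q.SepLocal M N →
    ∀ l, joint M N l (outcomes (Q.op M) ×ˢ outcomes (Q.op N))ᶜ = 0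
  trans_markov : ∀ T, IsMarkovKernel (trans T)
  resp_born : ∀ P M (a : ℝ),
    ∫ l, (resp M l).real {a} ∂(μ P) = born (Q.state P) (eigProj (Q.op M) a)
  resp_trans_born : ∀ P T M (a : ℝ),
    ∫ k, ∫ l, (resp M l).real {a} ∂(trans T k) ∂(μ P) =
      born ((Q.unitary T : S.Op) * Q.state P * star (Q.unitary T : S.Op)) (eigProj (Q.op M) a)
  joint_born : ∀ P M N, Q.SepLocal M N → ∀ a b : ℝ,
    ∫ l, (joint M N l).real {(a, b)} ∂(μ P) =
      born (Q.state P) (eigProj (Q.op M) a * eigProj (Q.op N) b)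
  joint_trans_born : ∀ P T M N, Q.SepLocal M N → ∀ a b : ℝ,
    ∫ k, ∫ l, (joint M N l).real {(a, b)} ∂(trans T k) ∂(μ P) =
      born ((Q.unitary T : S.Op) * Q.state P * star (Q.unitary T : S.Op))
        (eigProj (Q.op M) a * eigProj (Q.op N) b)

attribute [instance] OnticModel.measurableSpaceΛ

/-- Parameter independence: for local measurements on complementary subsystems, the probabilities
given the ontic state for the outcomes on one side do not depend on the measurement performed on
the other side. -/
def OnticModel.ParameterIndependent {S : QSys} {Q : Procedures S} (O : OnticModel Q) : Prop :=
  ∀ J : Finset S.parts, ∀ M ∈ Q.loc J, ∀ N ∈ Q.loc Jᶜ, ∀ l : O.Λ,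
    (∀ a : ℝ, O.resp M l {a} = ∑' b : ℝ, O.joint M N l {(a, b)}) ∧
    (∀ b : ℝ, O.resp N l {b} = ∑' a : ℝ, O.joint M N l {(a, b)})

/-- Triviality with respect to a set of measurements and a set of preparations: the probabilities
given the ontic state almost surely are the quantum mechanical ones. -/
def OnticModel.IsTrivial {S : QSys} {Q : Procedures S} (O : OnticModel Q)
    (𝓜 : Set Q.Meas) (𝓟 : Set Q.Prep) : Prop :=
  ∀ P ∈ 𝓟, ∀ M ∈ 𝓜, ∀ a : ℝ,
    ∀ᵐ l ∂(O.μ P), (O.resp M l).real {a} = born (Q.state P) (eigProj (Q.op M) a)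

/-- Triviality with respect to a set of pairs of local measurements that are both performed. -/
def OnticModel.IsJointlyTrivial {S : QSys} {Q : Procedures S} (O : OnticModel Q)
    (𝓜 : Set (Q.Meas × Q.Meas)) (𝓟 : Set Q.Prep) : Prop :=
  ∀ P ∈ 𝓟, ∀ M ∈ 𝓜, ∀ a b : ℝ,
    ∀ᵐ l ∂(O.μ P), (O.joint M.1 M.2 l).real {(a, b)} =
      born (Q.state P) (eigProj (Q.op M.1) a * eigProj (Q.op M.2) b)

/-! ## Complete ontic models -/

/-- A complete ontic model: an ontic model for every finite-dimensional quantum system, and for all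
systems `S`, `R` and every preparation of the ancilla `R` a Markov kernel that models
appending the ancilla, so prepared, to `S`. -/
structure CompleteOnticModel (Q : ∀ S : QSys, Procedures.{u} S) where
  model : ∀ S, OnticModel.{u, v} (Q S)
  append : ∀ S R : QSys, (Q R).Prep → Kernel (model S).Λ (model (S.prod R)).Λ
  append_markov : ∀ S R P₂, IsMarkovKernel (append S R P₂)
  append_prep : ∀ S R P₂ P₁, ∃ P : (Q (S.prod R)).Prep,
    (model (S.prod R)).μ P = ((model S).μ P₁).bind (append S R P₂) ∧
    (Q (S.prod R)).state P = QSys.prodOp ((Q S).state P₁) ((Q R).state P₂)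

/-- A complete ontic model is parameter independent if all its ontic models are. -/
def CompleteOnticModel.ParameterIndependent {Q : ∀ S : QSys, Procedures S}
    (C : CompleteOnticModel Q) : Prop :=
  ∀ S, (C.model S).ParameterIndependent

/-- Ancilla independence: for every measurement `M` on `S`, represented by `A`, there is a
measurement `N` on the joint system of `S` and `R`, represented by `A ⊗ 𝟙` and local to the
same parts of `S` as `M`, such that, however the ancilla `R` is prepared, the probabilities for `M`
given the ontic state are the averages of those for `N`. -/
def CompleteOnticModel.AncillaIndependent {Q : ∀ S : QSys, Procedures S}
    (C : CompleteOnticModel Q) : Prop :=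
  ∀ (S R : QSys) (M : (Q S).Meas), ∃ N : (Q (S.prod R)).Meas,
    (Q (S.prod R)).op N = QSys.prodOp ((Q S).op M) 1 ∧
    (∀ J : Finset S.parts, M ∈ (Q S).loc J →
      N ∈ (Q (S.prod R)).loc (J.map Function.Embedding.inl)) ∧
    ∀ (P₂ : (Q R).Prep) (a : ℝ) (l : (C.model S).Λ),
      (C.model S).resp M l {a} =
        ∫⁻ k, (C.model (S.prod R)).resp N k {a} ∂(C.append S R P₂ l)

/-! ## The measurements and preparations of the theorem -/

/-- The measurements performed locally on `J` whose operator on the space of `J` is diagonal in `e`. -/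
def Procedures.locDiag {S : QSys} (Q : Procedures S) (J : Finset S.parts) {d : ℕ}
    (e : OrthonormalBasis (Fin d) ℂ (EuclideanSpace ℂ (S.SubIdx J))) : Set Q.Meas :=
  {M | M ∈ Q.loc J ∧ ∃ a : Fin d → ℝ, Q.op M = S.embed J (diagOp e a)}

/-- Same, with a complete (i.e. non-degenerate) operator. -/
def Procedures.locDiagComplete {S : QSys} (Q : Procedures S) (J : Finset S.parts) {d : ℕ}
    (e : OrthonormalBasis (Fin d) ℂ (EuclideanSpace ℂ (S.SubIdx J))) : Set Q.Meas :=
  {M | M ∈ Q.loc J ∧ ∃ a : Fin d → ℝ, Function.Injective a ∧ Q.op M = S.embed J (diagOp e a)}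

/-- The preparations represented by the pure state `ψ`. -/
def Procedures.prepsOf {S : QSys} (Q : Procedures S) (ψ : EuclideanSpace ℂ S.Idx) : Set Q.Prep :=
  {P | Q.state P = pureState ψ}

end Ontic

end

namespace Ontic

open scoped Kronecker

/-! ## Local operators and tensor products -/

/-! Perfect correlations and parameter independence tie the response probabilities of the two sides
together. Given the ontic state, each marginal dominates the joint probability, so for events on
opposite sides the difference of their probabilities is at most the probability that exactly one of
them happens. The average of the latter is a Born probability, so quantum mechanics bounds an L¹
distance of response probabilities (`OnticModel.ParameterIndependent.integral_abs_sub_le`).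

Suppose that two Schmidt coefficients γ_x, γ_y are nearly equal. In the plane of the two Schmidt
vectors the state is then nearly invariant under the same real rotation on both sides, so
projections rotated by close angles on opposite sides nearly always agree. Going back and forth
between the sides, n small rotations lead from x to y at an L¹ cost of order n(γ_x − γ_y)² + γ_x²/n
(`integral_abs_sub_le_chain`). Nearly equal coefficients thus give nearly equal response
probabilities.

Unequal coefficients γ_i, γ_j are matched by an entangled ancilla that resembles an embezzling
state. Let r be a rational number close to γ_i²/γ_j². The ancilla has L + 1 blocks of equal total
weight; within a block all squared coefficients agree, and they grow by the factor r from one block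
to the next while the number of coefficients shrinks by the same factor. So i with block k and j
with block k + 1 have nearly the same coefficients, but the multiplicities differ by the factor r.
Summing over the blocks gives p_i ≈ r p_j, apart from two unmatched outer blocks of weight O(1/L).
Ancilla independence brings this estimate back to the original system
(`integral_abs_sub_le_of_ancilla`). In the limit, the p_i are almost surely proportional to γ_i²;
since they sum to 1, they equal γ_i².

This settles non-degenerate measurements on the first side. Correlations with a non-degenerate
measurement on the opposite side extend it to all diagonal measurements on the second side and then
on the first. For joint outcomes, a joint probability either has average zero or has the same
average as a marginal that dominates it. -/

/-- A label of the whole system amounts to a pair of labels of two complementary subsystems. -/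
def QSys.split (S : QSys) (J : Finset S.parts) : S.Idx ≃ S.SubIdx J × S.SubIdx Jᶜ where
  toFun x := (S.res J x, S.res Jᶜ x)
  invFun p i := if h : i ∈ J then p.1 ⟨i, h⟩ else p.2 ⟨i, Finset.mem_compl.2 h⟩
  left_inv x := by
    funext i
    by_cases h : i ∈ J <;> simp [h, QSys.res]
  right_inv p := by
    refine Prod.ext ?_ ?_
    · funext i
      simp [QSys.res]
    · funext i
      have h : (i : S.parts) ∉ J := Finset.mem_compl.1 i.2
      simp [QSys.res, h]

/-- A label of a joint system amounts to a pair of labels. -/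
def QSys.splitProd (S R : QSys) : (S.prod R).Idx ≃ S.Idx × R.Idx :=
  Equiv.sumPiEquivProdPi fun i => Fin ((S.prod R).dim i)

lemma QSys.res_eq_iff (S : QSys) (J : Finset S.parts) (x y : S.Idx) :
    S.res J x = S.res J y ↔ ∀ i ∈ J, x i = y i := by
  simp [funext_iff, QSys.res]

lemma QSys.embed_eq_submatrix (S : QSys) (J : Finset S.parts)
    (A : Matrix (S.SubIdx J) (S.SubIdx J) ℂ) :
    S.embed J A = (A ⊗ₖ (1 : Matrix (S.SubIdx Jᶜ) (S.SubIdx Jᶜ) ℂ)).submatrix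
      (S.split J) (S.split J) := by
  ext x y
  have h : (∀ i, i ∉ J → x i = y i) ↔ S.res Jᶜ x = S.res Jᶜ y := by
    simp [QSys.res_eq_iff]
  simp [QSys.embed, QSys.split, Matrix.one_apply, h]

/-- Both sides are written through the same equivalence `S.split J`, so that products of operators
on opposite sides become Kronecker products. -/
lemma QSys.embed_compl_eq_submatrix (S : QSys) (J : Finset S.parts)
    (B : Matrix (S.SubIdx Jᶜ) (S.SubIdx Jᶜ) ℂ) :
    S.embed Jᶜ B = ((1 : Matrix (S.SubIdx J) (S.SubIdx J) ℂ) ⊗ₖ B).submatrix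
      (S.split J) (S.split J) := by
  ext x y
  simp [QSys.embed, QSys.split, Matrix.one_apply, QSys.res_eq_iff]

lemma QSys.prodOp_eq_submatrix {S R : QSys} (A : S.Op) (B : R.Op) :
    QSys.prodOp A B = (A ⊗ₖ B).submatrix (S.splitProd R) (S.splitProd R) := by
  ext x y
  simp [QSys.prodOp, QSys.splitProd, Equiv.sumPiEquivProdPi]

lemma QSys.embed_apply_of_forall (S : QSys) (J : Finset S.parts)
    (A : Matrix (S.SubIdx J) (S.SubIdx J) ℂ) {x y : S.Idx} (h : ∀ i, i ∉ J → x i = y i) :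
    S.embed J A x y = A (S.res J x) (S.res J y) :=
  if_pos h

lemma QSys.embed_apply_of_not_forall (S : QSys) (J : Finset S.parts)
    (A : Matrix (S.SubIdx J) (S.SubIdx J) ℂ) {x y : S.Idx} (h : ¬∀ i, i ∉ J → x i = y i) :
    S.embed J A x y = 0 :=
  if_neg h

section Embed

variable (S : QSys) (J : Finset S.parts)

lemma QSys.embed_mul (A B : Matrix (S.SubIdx J) (S.SubIdx J) ℂ) :
    S.embed J (A * B) = S.embed J A * S.embed J B := by
  simp only [QSys.embed_eq_submatrix, Matrix.submatrix_mul_equiv, ← Matrix.mul_kronecker_mul,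
    Matrix.one_mul]

lemma QSys.embed_conjTranspose (A : Matrix (S.SubIdx J) (S.SubIdx J) ℂ) :
    S.embed J Aᴴ = (S.embed J A)ᴴ := by
  simp [QSys.embed_eq_submatrix, Matrix.conjTranspose_kronecker]

lemma QSys.embed_one : S.embed J 1 = 1 := by
  simp [QSys.embed_eq_submatrix]

/-- `QSys.embed` as a linear map. -/
def QSys.embedHom : Matrix (S.SubIdx J) (S.SubIdx J) ℂ →ₗ[ℂ] S.Op where
  toFun := S.embed J
  map_add' A B := by simp [QSys.embed_eq_submatrix, Matrix.add_kronecker]; rfl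
  map_smul' a A := by simp [QSys.embed_eq_submatrix, Matrix.smul_kronecker]; rfl

end Embed

lemma QSys.embed_mul_embed_compl (S : QSys) (J : Finset S.parts)
    (A : Matrix (S.SubIdx J) (S.SubIdx J) ℂ) (B : Matrix (S.SubIdx Jᶜ) (S.SubIdx Jᶜ) ℂ) :
    S.embed J A * S.embed Jᶜ B = (A ⊗ₖ B).submatrix (S.split J) (S.split J) := by
  rw [QSys.embed_eq_submatrix, QSys.embed_compl_eq_submatrix, Matrix.submatrix_mul_equiv,
    ← Matrix.mul_kronecker_mul, Matrix.one_mul, Matrix.mul_one]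

section ProdOp

variable {S R : QSys}

lemma QSys.prodOp_mul (A A' : S.Op) (B B' : R.Op) :
    QSys.prodOp A B * QSys.prodOp A' B' = QSys.prodOp (A * A') (B * B') := by
  simp only [QSys.prodOp_eq_submatrix, Matrix.submatrix_mul_equiv, ← Matrix.mul_kronecker_mul]

lemma QSys.prodOp_conjTranspose (A : S.Op) (B : R.Op) :
    (QSys.prodOp A B)ᴴ = QSys.prodOp Aᴴ Bᴴ := by
  simp [QSys.prodOp_eq_submatrix, Matrix.conjTranspose_kronecker]

lemma QSys.prodOp_one : QSys.prodOp (1 : S.Op) (1 : R.Op) = 1 := by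
  simp [QSys.prodOp_eq_submatrix]

lemma QSys.prodOp_trace (A : S.Op) (B : R.Op) :
    (QSys.prodOp A B).trace = A.trace * B.trace := by
  rw [QSys.prodOp_eq_submatrix, ← Matrix.trace_kronecker, Matrix.trace, Matrix.trace,
    ← Equiv.sum_comp (S.splitProd R)]
  rfl

/-- `QSys.prodOp` as a bilinear map. -/
def QSys.prodOpHom : S.Op →ₗ[ℂ] R.Op →ₗ[ℂ] (S.prod R).Op :=
  LinearMap.mk₂ ℂ QSys.prodOp
    (fun A A' B => by simp [QSys.prodOp_eq_submatrix, Matrix.add_kronecker]; rfl)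
    (fun a A B => by simp [QSys.prodOp_eq_submatrix, Matrix.smul_kronecker]; rfl)
    (fun A B B' => by simp [QSys.prodOp_eq_submatrix, Matrix.kronecker_add]; rfl)
    (fun a A B => by simp [QSys.prodOp_eq_submatrix, Matrix.kronecker_smul]; rfl)

lemma QSys.sum_prodOp {ι : Type*} (s : Finset ι) (A : ι → S.Op) (B : R.Op) :
    ∑ i ∈ s, QSys.prodOp (A i) B = QSys.prodOp (∑ i ∈ s, A i) B :=
  (LinearMap.map_sum₂ QSys.prodOpHom s A B).symm

lemma QSys.prodOp_sum {ι : Type*} (s : Finset ι) (A : S.Op) (B : ι → R.Op) :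
    ∑ i ∈ s, QSys.prodOp A (B i) = QSys.prodOp A (∑ i ∈ s, B i) :=
  (map_sum (QSys.prodOpHom A) B s).symm

lemma QSys.smul_prodOp (a : ℂ) (A : S.Op) (B : R.Op) :
    QSys.prodOp (a • A) B = a • QSys.prodOp A B :=
  LinearMap.map_smul₂ QSys.prodOpHom a A B

end ProdOp

/-- Operators `A ⊗ 𝟙`, where `A` acts on the subsystem with parts in `J`. -/
def QSys.localOps (S : QSys) (J : Finset S.parts) : Submodule ℂ S.Op :=
  LinearMap.range (S.embedHom J)

lemma QSys.embed_mem_localOps (S : QSys) (J : Finset S.parts)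
    (A : Matrix (S.SubIdx J) (S.SubIdx J) ℂ) : S.embed J A ∈ S.localOps J :=
  ⟨A, rfl⟩

/-- Replacing a preimage by its Hermitian part makes it unnecessary to know that `embed` is
injective. -/
lemma QSys.exists_isHermitian_of_mem_localOps {S : QSys} {J : Finset S.parts} {X : S.Op}
    (hX : X ∈ S.localOps J) (h : X.IsHermitian) :
    ∃ A : Matrix (S.SubIdx J) (S.SubIdx J) ℂ, A.IsHermitian ∧ X = S.embed J A := by
  obtain ⟨A, rfl⟩ := hX
  refine ⟨(2⁻¹ : ℝ) • (A + Aᴴ), ?_, ?_⟩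
  · rw [Matrix.IsHermitian, Matrix.conjTranspose_smul, Matrix.conjTranspose_add,
      Matrix.conjTranspose_conjTranspose, star_trivial, add_comm]
  · have h' : S.embedHom J Aᴴ = S.embedHom J A := (S.embed_conjTranspose J A).trans h
    change _ = S.embedHom J _
    rw [← Complex.coe_smul, map_smul, map_add, h', ← two_smul ℂ, smul_smul]
    simp

lemma QSys.prodOp_mem_localOps {S R : QSys} {J : Finset S.parts} {K : Finset R.parts}
    {X : S.Op} {Y : R.Op} (hX : X ∈ S.localOps J) (hY : Y ∈ R.localOps K) :
    QSys.prodOp X Y ∈ (S.prod R).localOps (J.disjSum K) := by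
  obtain ⟨A, rfl⟩ := hX
  obtain ⟨B, rfl⟩ := hY
  refine ⟨Matrix.of fun x y =>
    A (fun i => x ⟨Sum.inl i, Finset.inl_mem_disjSum.2 i.2⟩)
      (fun i => y ⟨Sum.inl i, Finset.inl_mem_disjSum.2 i.2⟩) *
    B (fun i => x ⟨Sum.inr i, Finset.inr_mem_disjSum.2 i.2⟩)
      (fun i => y ⟨Sum.inr i, Finset.inr_mem_disjSum.2 i.2⟩), ?_⟩
  ext x y
  have h : (∀ i, i ∉ J.disjSum K → x i = y i) ↔
      (∀ i, i ∉ J → x (Sum.inl i) = y (Sum.inl i)) ∧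
        ∀ i, i ∉ K → x (Sum.inr i) = y (Sum.inr i) := by
    simp [Sum.forall]
  change (S.prod R).embed (J.disjSum K) _ x y =
    S.embed J A (fun i => x (Sum.inl i)) (fun i => y (Sum.inl i)) *
      R.embed K B (fun i => x (Sum.inr i)) (fun i => y (Sum.inr i))
  by_cases h1 : ∀ i, i ∉ J → x (Sum.inl i) = y (Sum.inl i)
  · by_cases h2 : ∀ i, i ∉ K → x (Sum.inr i) = y (Sum.inr i)
    · rw [QSys.embed_apply_of_forall _ _ _ h1, QSys.embed_apply_of_forall _ _ _ h2,
        QSys.embed_apply_of_forall _ _ _ (h.2 ⟨h1, h2⟩)]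
      rfl
    · rw [QSys.embed_apply_of_not_forall _ _ _ h2, mul_zero,
        QSys.embed_apply_of_not_forall _ _ _ fun h' => h2 (h.1 h').2]
  · rw [QSys.embed_apply_of_not_forall _ _ _ h1, zero_mul,
        QSys.embed_apply_of_not_forall _ _ _ fun h' => h1 (h.1 h').1]

/-! ## Spectral projections -/

section Spectral

variable {n : Type} [Fintype n] [DecidableEq n]

/-- An orthogonal projection is determined by P v lying in the subspace and v − P v being orthogonal
to it. The latter holds since ⟨P v, w⟩ = ⟨v, P w⟩ = ⟨v, w⟩ for every eigenvector w. -/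
lemma eigProj_eq_of_forall {A P : Matrix n n ℂ} {a : ℝ} (hP : P.IsHermitian)
    (hAP : A * P = (a : ℂ) • P)
    (hfix : ∀ w : n → ℂ, A *ᵥ w = (a : ℂ) • w → P *ᵥ w = w) : eigProj A a = P := by
  rw [eigProj, LinearEquiv.symm_apply_eq]
  refine LinearMap.ext fun v => ?_
  rw [ContinuousLinearMap.coe_coe]
  refine Submodule.eq_starProjection_of_mem_of_inner_eq_zero ?_ fun w hw => ?_
  · rw [Module.End.mem_eigenspace_iff]
    apply WithLp.ofLp_injective 2
    simp only [Matrix.ofLp_toLpLin, Matrix.toLin'_apply, WithLp.ofLp_smul, Matrix.mulVec_mulVec, hAP,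
      Matrix.smul_mulVec]
  · rw [Module.End.mem_eigenspace_iff] at hw
    have hw' : P *ᵥ w.ofLp = w.ofLp := by
      refine hfix _ ?_
      rw [← Matrix.toLin'_apply, ← Matrix.ofLp_toLpLin 2 2, hw, WithLp.ofLp_smul]
    rw [inner_sub_left, sub_eq_zero]
    simp only [EuclideanSpace.inner_eq_star_dotProduct, Matrix.ofLp_toLpLin, Matrix.toLin'_apply]
    rw [dotProduct_comm, dotProduct_comm _ (star (P *ᵥ v.ofLp)), Matrix.star_mulVec, hP.eq,
      ← Matrix.dotProduct_mulVec, hw']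

lemma eigProj_one_of_isIdempotentElem {P : Matrix n n ℂ} (hP : P.IsHermitian)
    (h : IsIdempotentElem P) : eigProj P 1 = P :=
  eigProj_eq_of_forall hP (by simpa using h.eq) fun w hw => by simpa using hw

/-- The spectral projections of `∑ i, a i • Q i` for a complete family of orthogonal projections. -/
lemma eigProj_sum {ι : Type*} [Fintype ι] [DecidableEq ι] {Q : ι → Matrix n n ℂ}
    (hQ : ∀ i, (Q i).IsHermitian) (hmul : ∀ i j, Q i * Q j = if i = j then Q i else 0)
    (hsum : ∑ i, Q i = 1) (a : ι → ℝ) (x : ℝ) :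
    eigProj (∑ i, (a i : ℂ) • Q i) x = ∑ i with a i = x, Q i := by
  have hAQ (j : ι) : (∑ i, (a i : ℂ) • Q i) * Q j = (a j : ℂ) • Q j := by
    simp [Finset.sum_mul, hmul]
  have hQA (j : ι) : Q j * (∑ i, (a i : ℂ) • Q i) = (a j : ℂ) • Q j := by
    simp [Finset.mul_sum, hmul]
  refine eigProj_eq_of_forall ?_ ?_ fun w hw => ?_
  · rw [Matrix.IsHermitian, Matrix.conjTranspose_sum]
    exact Finset.sum_congr rfl fun i _ => hQ i
  · rw [Finset.mul_sum, Finset.smul_sum]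
    refine Finset.sum_congr rfl fun j hj => ?_
    rw [hAQ, (Finset.mem_filter.1 hj).2]
  -- Only the blocks with the right eigenvalue contribute to an eigenvector; the others are killed
  -- by comparing the two scalars.
  · have hz (j : ι) (hj : a j ≠ x) : Q j *ᵥ w = 0 := by
      have h1 : (a j : ℂ) • Q j *ᵥ w = (x : ℂ) • Q j *ᵥ w := by
        rw [← Matrix.smul_mulVec, ← hQA, ← Matrix.mulVec_mulVec, hw, Matrix.mulVec_smul]
      rw [← sub_eq_zero, ← sub_smul, smul_eq_zero, sub_eq_zero] at h1
      exact h1.resolve_left fun h => hj (by exact_mod_cast h)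
    calc (∑ i with a i = x, Q i) *ᵥ w = ∑ i with a i = x, Q i *ᵥ w := Matrix.sum_mulVec ..
      _ = ∑ i, Q i *ᵥ w := by
        refine Finset.sum_subset (Finset.subset_univ _) fun j _ hj => hz j ?_
        simpa using hj
      _ = w := by rw [← Matrix.sum_mulVec, hsum, Matrix.one_mulVec]

end Spectral

lemma trace_submatrix_equiv {m n : Type*} [Fintype m] [Fintype n] (A : Matrix m m ℂ)
    (s : n ≃ m) : (A.submatrix s s).trace = A.trace :=
  s.sum_comp fun i => A i i

/-! ## Matrix units and Schmidt decompositions -/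

/-- A complete system of matrix units. -/
structure IsMatrixUnits {n ι : Type*} [Fintype n] [DecidableEq n] [Fintype ι] [DecidableEq ι]
    (E : ι → ι → Matrix n n ℂ) : Prop where
  mul : ∀ x y z w, E x y * E z w = if y = z then E x w else 0
  conjTranspose : ∀ x y, (E x y)ᴴ = E y x
  sum : ∑ x, E x x = 1

/-- The projection onto the vector `cos t • e x + sin t • e y`. -/
noncomputable def IsMatrixUnits.rot {n ι : Type*} (E : ι → ι → Matrix n n ℂ) (x y : ι) (t : ℝ) :
    Matrix n n ℂ :=
  ((Real.cos t ^ 2 : ℝ) : ℂ) • E x x + ((Real.cos t * Real.sin t : ℝ) : ℂ) • (E x y + E y x) +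
    ((Real.sin t ^ 2 : ℝ) : ℂ) • E y y

lemma IsMatrixUnits.rot_zero {n ι : Type*} (E : ι → ι → Matrix n n ℂ) (x y : ι) :
    rot E x y 0 = E x x := by
  simp [rot]

lemma IsMatrixUnits.rot_pi_div_two {n ι : Type*} (E : ι → ι → Matrix n n ℂ) (x y : ι) :
    rot E x y (Real.pi / 2) = E y y := by
  simp [rot]

namespace IsMatrixUnits

variable {n ι : Type*} [Fintype n] [DecidableEq n] [Fintype ι] [DecidableEq ι]
  {E : ι → ι → Matrix n n ℂ}

lemma isHermitian (hE : IsMatrixUnits E) (x : ι) : (E x x).IsHermitian :=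
  hE.conjTranspose x x

lemma mul_diag (hE : IsMatrixUnits E) (x y : ι) :
    E x x * E y y = if x = y then E x x else 0 := by
  rw [hE.mul]
  split_ifs with h
  · rw [h]
  · rfl

/-- Phases of the Schmidt coefficients can be absorbed into the matrix units of one side. The
diagonal projections do not change. -/
lemma twist (hE : IsMatrixUnits E) {u : ι → ℂ} (hu : ∀ x, star (u x) * u x = 1) :
    IsMatrixUnits fun x y => (u x * star (u y)) • E x y where
  mul x y z w := by
    rw [Matrix.smul_mul, Matrix.mul_smul, hE.mul, smul_smul]
    split_ifs with h
    · subst h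
      congr 1
      linear_combination u x * star (u w) * hu y
    · simp
  conjTranspose x y := by
    rw [Matrix.conjTranspose_smul, hE.conjTranspose, star_mul, star_star]
  sum := by
    rw [← hE.sum]
    refine Finset.sum_congr rfl fun x _ => ?_
    rw [mul_comm, hu, one_smul]

lemma isHermitian_rot (hE : IsMatrixUnits E) (x y : ι) (t : ℝ) : (rot E x y t).IsHermitian := by
  simp only [Matrix.IsHermitian, rot, Matrix.conjTranspose_add, Matrix.conjTranspose_smul,
    hE.conjTranspose, RCLike.star_def, Complex.conj_ofReal]
  rw [add_comm (E y x)]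

lemma isIdempotentElem_rot (hE : IsMatrixUnits E) {x y : ι} (hxy : x ≠ y) (t : ℝ) :
    IsIdempotentElem (rot E x y t) := by
  have h := Complex.cos_sq_add_sin_sq (t : ℂ)
  simp only [IsIdempotentElem, rot, mul_add, add_mul, Matrix.smul_mul, Matrix.mul_smul, hE.mul,
    hxy, hxy.symm, if_true, if_false, smul_zero, add_zero, zero_add, smul_add, smul_smul]
  push_cast
  match_scalars
  · linear_combination Complex.cos t ^ 2 * h
  · linear_combination Complex.cos t * Complex.sin t * h
  · linear_combination Complex.cos t * Complex.sin t * h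
  · linear_combination Complex.sin t ^ 2 * h

end IsMatrixUnits

section Basis

variable {n : Type} [Fintype n] {ι : Type*} [Fintype ι] [DecidableEq ι]

/-- The operators `|e x⟩⟨e y|`. -/
noncomputable def ketBra (e : OrthonormalBasis ι ℂ (EuclideanSpace ℂ n)) (x y : ι) : Matrix n n ℂ :=
  Matrix.vecMulVec (e x) (star (e y).ofLp)

lemma ketBra_trace (e : OrthonormalBasis ι ℂ (EuclideanSpace ℂ n)) (x y : ι) :
    (ketBra e x y).trace = if x = y then 1 else 0 := by
  rw [ketBra, Matrix.trace_vecMulVec, ← EuclideanSpace.inner_eq_star_dotProduct,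
    orthonormal_iff_ite.1 e.orthonormal, if_congr eq_comm rfl rfl]

lemma isMatrixUnits_ketBra [DecidableEq n] (e : OrthonormalBasis ι ℂ (EuclideanSpace ℂ n)) :
    IsMatrixUnits (ketBra e) where
  mul x y z w := by
    have h : star (e y).ofLp ⬝ᵥ (e z).ofLp = if y = z then 1 else 0 := by
      rw [dotProduct_comm, ← EuclideanSpace.inner_eq_star_dotProduct,
        orthonormal_iff_ite.1 e.orthonormal]
    simp only [ketBra]
    rw [Matrix.vecMulVec_mul_vecMulVec, h]
    split_ifs <;> simp
  conjTranspose x y := by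
    simp [ketBra, Matrix.conjTranspose_vecMulVec]
  sum := by
    refine Matrix.ext_of_mulVec_single fun i => ?_
    have h := congrArg WithLp.ofLp (e.sum_repr' (WithLp.toLp 2 (Pi.single i 1)))
    rw [Matrix.one_mulVec, Matrix.sum_mulVec]
    refine Eq.trans ?_ h
    rw [WithLp.ofLp_sum]
    refine Finset.sum_congr rfl fun x _ => ?_
    rw [WithLp.ofLp_smul, EuclideanSpace.inner_eq_star_dotProduct, ketBra,
      Matrix.vecMulVec_mulVec, dotProduct_comm]
    simp

end Basis

/-- `E` and `F` are local matrix units on the two sides of the bipartition `J` of a system in the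
state `ρ`, which has the Schmidt coefficients `γ` with respect to them. -/
structure IsSchmidt (S : QSys) (J : Finset S.parts) (ρ : S.Op) {ι : Type*} [Fintype ι]
    [DecidableEq ι] (E F : ι → ι → S.Op) (γ : ι → ℝ) : Prop where
  left : IsMatrixUnits E
  right : IsMatrixUnits F
  left_mem : ∀ x y, E x y ∈ S.localOps J
  right_mem : ∀ x y, F x y ∈ S.localOps Jᶜ
  nonneg : ∀ x, 0 ≤ γ x
  trace : ∀ x y z w, (ρ * (E x y * F z w)).trace = if x = z ∧ y = w then (γ x * γ y : ℂ) else 0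

lemma IsMatrixUnits.embed {S : QSys} {J : Finset S.parts} {ι : Type*} [Fintype ι] [DecidableEq ι]
    {E : ι → ι → Matrix (S.SubIdx J) (S.SubIdx J) ℂ} (hE : IsMatrixUnits E) :
    IsMatrixUnits fun x y => S.embed J (E x y) where
  mul x y z w := by
    rw [← QSys.embed_mul, hE.mul]
    split_ifs
    · rfl
    · exact map_zero (S.embedHom J)
  conjTranspose x y := by
    rw [← QSys.embed_conjTranspose, hE.conjTranspose]
  sum := by
    rw [← S.embed_one J, ← hE.sum]
    exact (map_sum (S.embedHom J) _ _).symm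

lemma pureState_sum_prodVec {S : QSys} {J : Finset S.parts} {ι : Type*} [Fintype ι]
    [DecidableEq ι] (e : OrthonormalBasis ι ℂ (EuclideanSpace ℂ (S.SubIdx J)))
    (f : OrthonormalBasis ι ℂ (EuclideanSpace ℂ (S.SubIdx Jᶜ))) (c : ι → ℂ) :
    pureState (∑ i, c i • S.prodVec J (e i) (f i)) =
      ∑ v, ∑ w, (c v * star (c w)) •
        (ketBra e v w ⊗ₖ ketBra f v w).submatrix (S.split J) (S.split J) := by
  ext x y
  simp only [pureState, QSys.prodVec, Matrix.vecMulVec_apply, Matrix.sum_apply, Matrix.smul_apply,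
    Matrix.submatrix_apply, Matrix.kroneckerMap_apply, ketBra, WithLp.ofLp_sum, WithLp.ofLp_smul,
    Finset.sum_apply, Pi.smul_apply, smul_eq_mul, star_sum, star_mul', Finset.sum_mul_sum,
    Pi.star_apply, QSys.split, Equiv.coe_fn_mk]
  refine Finset.sum_congr rfl fun v _ => Finset.sum_congr rfl fun w _ => ?_
  ring

/-- The phases `u` move into the second family of matrix units, which leaves the nonnegative
coefficients `γ`. Only this real form makes equal real rotations on the two sides correlated. -/
lemma isSchmidt_of_basis {S : QSys} {J : Finset S.parts} {ι : Type*} [Fintype ι] [DecidableEq ι]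
    (e : OrthonormalBasis ι ℂ (EuclideanSpace ℂ (S.SubIdx J)))
    (f : OrthonormalBasis ι ℂ (EuclideanSpace ℂ (S.SubIdx Jᶜ))) {c u : ι → ℂ} {γ : ι → ℝ}
    (hγ : ∀ i, 0 ≤ γ i) (hu : ∀ i, star (u i) * u i = 1) (hc : ∀ i, c i = γ i * u i) :
    IsSchmidt S J (pureState (∑ i, c i • S.prodVec J (e i) (f i)))
      (fun x y => S.embed J (ketBra e x y))
      (fun x y => (u x * star (u y)) • S.embed Jᶜ (ketBra f x y)) γ where
  left := (isMatrixUnits_ketBra e).embed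
  right := (isMatrixUnits_ketBra f).embed.twist hu
  left_mem x y := S.embed_mem_localOps J _
  right_mem x y := Submodule.smul_mem _ _ (S.embed_mem_localOps Jᶜ _)
  nonneg := hγ
  trace x y z w := by
    have key (v v' : ι) : ((ketBra e v v' ⊗ₖ ketBra f v v').submatrix (S.split J) (S.split J) *
        (S.embed J (ketBra e x y) * S.embed Jᶜ (ketBra f z w))).trace =
        if v' = x ∧ v' = z ∧ v = y ∧ v = w then 1 else 0 := by
      rw [QSys.embed_mul_embed_compl, Matrix.submatrix_mul_equiv, ← Matrix.mul_kronecker_mul,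
        trace_submatrix_equiv, Matrix.trace_kronecker, (isMatrixUnits_ketBra e).mul,
        (isMatrixUnits_ketBra f).mul]
      simp only [apply_ite Matrix.trace, ketBra_trace, Matrix.trace_zero, ← ite_and,
        ite_zero_mul_ite_zero, mul_one]
      exact if_congr (by tauto) rfl rfl
    rw [pureState_sum_prodVec, Matrix.mul_smul, Matrix.mul_smul, Matrix.trace_smul,
      Finset.sum_mul, Matrix.trace_sum]
    simp_rw [Finset.sum_mul, Matrix.trace_sum, Matrix.smul_mul, Matrix.trace_smul, key]
    by_cases hxz : x = z
    · by_cases hyw : y = w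
      · subst hxz hyw
        rw [Finset.sum_eq_single y, Finset.sum_eq_single x]
        · simp only [and_self, if_true, smul_eq_mul, mul_one, hc, star_mul', RCLike.star_def,
            Complex.conj_ofReal]
          have h1 := hu x
          have h2 := hu y
          rw [RCLike.star_def] at h1 h2
          linear_combination (γ x * γ y : ℂ) * (starRingEnd ℂ (u y) * u y) * h1 +
            (γ x * γ y : ℂ) * h2
        · intro b _ hb
          simp [hb]
        · simp
        · intro b _ hb
          simp [hb]
        · simp
      · rw [if_neg fun h => hyw h.2]
        refine smul_eq_zero_of_right _ (Finset.sum_eq_zero fun v _ =>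
          Finset.sum_eq_zero fun v' _ => ?_)
        rw [if_neg, smul_zero]
        rintro ⟨-, -, rfl, h⟩
        exact hyw h
    · rw [if_neg fun h => hxz h.1]
      refine smul_eq_zero_of_right _ (Finset.sum_eq_zero fun v _ =>
        Finset.sum_eq_zero fun v' _ => ?_)
      rw [if_neg, smul_zero]
      rintro ⟨rfl, h, -⟩
      exact hxz h

/-! ### Born probabilities in a Schmidt decomposition -/

lemma born_add {n : Type} [Fintype n] (ρ A B : Matrix n n ℂ) :
    born ρ (A + B) = born ρ A + born ρ B := by
  simp [born, mul_add]

lemma born_sum {n : Type} [Fintype n] {ι : Type*} (ρ : Matrix n n ℂ) (s : Finset ι)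
    (A : ι → Matrix n n ℂ) : born ρ (∑ i ∈ s, A i) = ∑ i ∈ s, born ρ (A i) := by
  simp [born, Finset.mul_sum, Matrix.trace_sum]

lemma born_smul {n : Type} [Fintype n] (ρ : Matrix n n ℂ) (r : ℝ) (A : Matrix n n ℂ) :
    born ρ ((r : ℂ) • A) = r * born ρ A := by
  simp [born, Matrix.trace_smul]

namespace IsSchmidt

variable {S : QSys} {J : Finset S.parts} {ρ : S.Op} {ι : Type*} [Fintype ι] [DecidableEq ι]
  {E F : ι → ι → S.Op} {γ : ι → ℝ}

lemma born_mul (h : IsSchmidt S J ρ E F γ) (x y z w : ι) :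
    born ρ (E x y * F z w) = if x = z ∧ y = w then γ x * γ y else 0 := by
  rw [born, h.trace]
  split_ifs <;> simp

/-- Inserting the resolution of the identity of the other side turns the marginal into a sum of
known correlations. -/
lemma born_left (h : IsSchmidt S J ρ E F γ) (x y : ι) :
    born ρ (E x y) = if x = y then γ x ^ 2 else 0 := by
  rw [← Matrix.mul_one (E x y), ← h.right.sum, Finset.mul_sum, born_sum]
  simp only [h.born_mul]
  split_ifs with hxy
  · subst hxy
    simp [sq]
  · refine Finset.sum_eq_zero fun z _ => if_neg ?_
    rintro ⟨rfl, rfl⟩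
    exact hxy rfl

lemma born_right (h : IsSchmidt S J ρ E F γ) (z w : ι) :
    born ρ (F z w) = if z = w then γ z ^ 2 else 0 := by
  rw [← Matrix.one_mul (F z w), ← h.left.sum, Finset.sum_mul, born_sum]
  simp only [h.born_mul]
  split_ifs with hzw
  · subst hzw
    simp [sq]
  · refine Finset.sum_eq_zero fun z _ => if_neg ?_
    rintro ⟨rfl, rfl⟩
    exact hzw rfl

lemma born_diag_mul_diag (h : IsSchmidt S J ρ E F γ) (x y : ι) :
    born ρ (E x x * F y y) = if x = y then γ x ^ 2 else 0 := by
  simp only [h.born_mul, and_self, sq]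

lemma trace_eq (h : IsSchmidt S J ρ E F γ) : ρ.trace = ((∑ x, γ x ^ 2 : ℝ) : ℂ) := by
  have h1 : ρ = ρ * ((∑ x, E x x) * ∑ y, F y y) := by
    rw [h.left.sum, h.right.sum, mul_one, mul_one]
  rw [h1, Finset.sum_mul_sum, Finset.mul_sum, Matrix.trace_sum]
  push_cast
  refine Finset.sum_congr rfl fun x _ => ?_
  rw [Finset.mul_sum, Matrix.trace_sum]
  simp [h.trace, sq]

open IsMatrixUnits

lemma born_rot_left (h : IsSchmidt S J ρ E F γ) {x y : ι} (hxy : x ≠ y) (t : ℝ) :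
    born ρ (rot E x y t) = Real.cos t ^ 2 * γ x ^ 2 + Real.sin t ^ 2 * γ y ^ 2 := by
  simp only [rot, born_add, born_smul, h.born_left, hxy, hxy.symm, if_true, if_false]
  ring

lemma born_rot_right (h : IsSchmidt S J ρ E F γ) {x y : ι} (hxy : x ≠ y) (t : ℝ) :
    born ρ (rot F x y t) = Real.cos t ^ 2 * γ x ^ 2 + Real.sin t ^ 2 * γ y ^ 2 := by
  simp only [rot, born_add, born_smul, h.born_right, hxy, hxy.symm, if_true, if_false]
  ring

lemma born_rot_mul_rot (h : IsSchmidt S J ρ E F γ) {x y : ι} (hxy : x ≠ y) (s t : ℝ) :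
    born ρ (rot E x y s * rot F x y t) =
      (γ x * (Real.cos s * Real.cos t) + γ y * (Real.sin s * Real.sin t)) ^ 2 := by
  simp only [rot, add_mul, mul_add, Matrix.smul_mul, Matrix.mul_smul, smul_add, smul_smul,
    ← Complex.ofReal_mul]
  simp only [born_add, born_smul, h.born_mul, hxy, hxy.symm, if_true, if_false, and_self,
    and_true, and_false]
  ring

/-- The probability that the rotated projections on the two sides have different outcomes. -/
lemma born_rot_disagree_le (h : IsSchmidt S J ρ E F γ) {x y : ι} (hxy : x ≠ y) (s t : ℝ) :
    born ρ (rot E x y s) + born ρ (rot F x y t) - 2 * born ρ (rot E x y s * rot F x y t) ≤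
      4 * γ x ^ 2 * (s - t) ^ 2 + 4 * (γ x - γ y) ^ 2 := by
  rw [h.born_rot_left hxy, h.born_rot_right hxy, h.born_rot_mul_rot hxy]
  have hs := Real.sin_sq_add_cos_sq s
  have ht := Real.sin_sq_add_cos_sq t
  have hst : Real.sin (s - t) ^ 2 ≤ (s - t) ^ 2 := by
    rw [← sq_abs, ← sq_abs (s - t)]
    exact pow_le_pow_left₀ (abs_nonneg _) Real.abs_sin_le_abs 2
  rw [Real.sin_sub] at hst
  generalize Real.sin s = a at *
  generalize Real.cos s = b at *
  generalize Real.sin t = c at *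
  generalize Real.cos t = d at *
  generalize γ x = p at *
  generalize γ y = q at *
  -- The two squares are the squared amplitudes of the two mixed outcomes; for equal coefficients p
  -- = q they add up to 2p² sin²(s − t).
  have e1 : b ^ 2 * p ^ 2 + a ^ 2 * q ^ 2 + (d ^ 2 * p ^ 2 + c ^ 2 * q ^ 2) -
      2 * (p * (b * d) + q * (a * c)) ^ 2 =
      (p * b * c - q * a * d) ^ 2 + (p * a * d - q * b * c) ^ 2 := by
    linear_combination (-(p ^ 2 * b ^ 2) - q ^ 2 * a ^ 2) * ht +
      (-(p ^ 2 * d ^ 2) - q ^ 2 * c ^ 2) * hs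
  -- Here pbc − qad = p(bc − ad) + (p − q)ad, combined with (u + v)² ≤ 2u² + 2v²; the next bound is
  -- symmetric to it.
  have e2 : (p * b * c - q * a * d) ^ 2 ≤ 2 * p ^ 2 * (a * d - b * c) ^ 2 +
      2 * (p - q) ^ 2 := by
    have h1 : (a * d) ^ 2 ≤ 1 := by nlinarith [sq_nonneg a, sq_nonneg d, sq_nonneg b, sq_nonneg c]
    have h2 := mul_le_mul_of_nonneg_left h1 (sq_nonneg (p - q))
    nlinarith [sq_nonneg (p * (b * c - a * d) - (p - q) * (a * d))]
  have e3 : (p * a * d - q * b * c) ^ 2 ≤ 2 * p ^ 2 * (a * d - b * c) ^ 2 +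
      2 * (p - q) ^ 2 := by
    have h1 : (b * c) ^ 2 ≤ 1 := by nlinarith [sq_nonneg a, sq_nonneg d, sq_nonneg b, sq_nonneg c]
    have h2 := mul_le_mul_of_nonneg_left h1 (sq_nonneg (p - q))
    nlinarith [sq_nonneg (p * (a * d - b * c) - (p - q) * (b * c))]
  have e4 := mul_le_mul_of_nonneg_left hst (sq_nonneg p)
  rw [e1]
  linarith

end IsSchmidt

/-! ### Products of Schmidt decompositions and entangled ancillas -/

lemma compl_disjSum {α β : Type*} [Fintype α] [Fintype β] [DecidableEq α] [DecidableEq β]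
    (s : Finset α) (t : Finset β) : (s.disjSum t)ᶜ = sᶜ.disjSum tᶜ := by
  ext (a | b) <;> simp

section Prod

variable {S R : QSys} {ι κ : Type*} [Fintype ι] [DecidableEq ι] [Fintype κ] [DecidableEq κ]

lemma IsMatrixUnits.prodOp {E : ι → ι → S.Op} {E' : κ → κ → R.Op}
    (h : IsMatrixUnits E) (h' : IsMatrixUnits E') :
    IsMatrixUnits fun x y : ι × κ =>
      (QSys.prodOp (E x.1 y.1) (E' x.2 y.2) : (S.prod R).Op) where
  mul x y z w := by
    rw [QSys.prodOp_mul, h.mul, h'.mul]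
    by_cases h1 : y.1 = z.1
    · by_cases h2 : y.2 = z.2
      · simp [Prod.ext_iff, h1, h2]
      · simp only [Prod.ext_iff, h1, h2, and_false, if_false]
        exact map_zero (QSys.prodOpHom _)
    · simp only [Prod.ext_iff, h1, false_and, if_false]
      exact LinearMap.map_zero₂ QSys.prodOpHom _
  conjTranspose x y := by
    rw [QSys.prodOp_conjTranspose, h.conjTranspose, h'.conjTranspose]
  sum := by
    rw [Fintype.sum_prod_type]
    simp only [QSys.prodOp_sum, QSys.sum_prodOp, h.sum, h'.sum, QSys.prodOp_one]

lemma IsSchmidt.prod {J : Finset S.parts} {K : Finset R.parts} {ρ : S.Op} {σ : R.Op}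
    {E F : ι → ι → S.Op} {E' F' : κ → κ → R.Op} {γ : ι → ℝ} {γ' : κ → ℝ}
    (h : IsSchmidt S J ρ E F γ) (h' : IsSchmidt R K σ E' F' γ') :
    IsSchmidt (S.prod R) (J.disjSum K) (QSys.prodOp ρ σ)
      (fun x y : ι × κ => QSys.prodOp (E x.1 y.1) (E' x.2 y.2))
      (fun x y : ι × κ => QSys.prodOp (F x.1 y.1) (F' x.2 y.2))
      (fun x => γ x.1 * γ' x.2) where
  left := h.left.prodOp h'.left
  right := h.right.prodOp h'.right
  left_mem x y := QSys.prodOp_mem_localOps (h.left_mem _ _) (h'.left_mem _ _)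
  right_mem x y := by
    have hJK : (J.disjSum K : Finset (S.prod R).parts)ᶜ = Jᶜ.disjSum Kᶜ := compl_disjSum J K
    rw [hJK]
    exact QSys.prodOp_mem_localOps (h.right_mem _ _) (h'.right_mem _ _)
  nonneg x := mul_nonneg (h.nonneg _) (h'.nonneg _)
  trace x y z w := by
    rw [QSys.prodOp_mul, QSys.prodOp_mul, QSys.prodOp_trace, h.trace, h'.trace,
      ite_zero_mul_ite_zero]
    refine if_congr ?_ ?_ rfl
    · rw [Prod.ext_iff, Prod.ext_iff]
      tauto
    · push_cast
      ring

end Prod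

/-- Every list of Schmidt coefficients occurs for a pair of systems. -/
lemma exists_isSchmidt {κ : Type} [Fintype κ] [DecidableEq κ] {γ : κ → ℝ}
    (hγ : ∀ x, 0 ≤ γ x) (hsum : ∑ x, γ x ^ 2 = 1) :
    ∃ (R : QSys) (K : Finset R.parts) (σ : R.Op) (E F : κ → κ → R.Op),
      IsDensity σ ∧ IsSchmidt R K σ E F γ := by
  have hpos : 0 < Fintype.card κ := by
    rw [Fintype.card_pos_iff]
    by_contra h
    rw [not_nonempty_iff] at h
    simp at hsum
  -- Two parts of equal dimension, one on each side of the bipartition; the sides have as many basis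
  -- vectors as there are coefficients.
  let R : QSys := { parts := Bool, dim := fun _ => Fintype.card κ, dim_pos := fun _ => hpos }
  let K : Finset R.parts := ({true} : Finset Bool)
  have basis (L : Finset R.parts) (hL : L.card = 1) :
      Nonempty (OrthonormalBasis κ ℂ (EuclideanSpace ℂ (R.SubIdx L))) := by
    have hcard : Fintype.card (R.SubIdx L) = Fintype.card κ := by
      simp [R, hL]
    exact ⟨(EuclideanSpace.basisFun _ ℂ).reindex (Fintype.equivOfCardEq hcard)⟩
  obtain ⟨e⟩ := basis K rfl
  obtain ⟨f⟩ := basis Kᶜ rfl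
  have h := isSchmidt_of_basis e f (c := fun i => (γ i : ℂ)) (u := fun _ => 1) hγ (by simp)
    (by simp)
  refine ⟨R, K, _, _, _, ⟨Matrix.posSemidef_vecMulVec_self_star _, ?_⟩, h⟩
  exact h.trace_eq.trans (by rw [hsum, Complex.ofReal_one])

/-! ### Estimates in L¹ -/

section L1

variable {Ω : Type*} [MeasurableSpace Ω] {μ : Measure Ω}

lemma integral_abs_sub_triangle {f g h : Ω → ℝ} (hf : Integrable f μ) (hg : Integrable g μ)
    (hh : Integrable h μ) :
    ∫ l, |f l - h l| ∂μ ≤ ∫ l, |f l - g l| ∂μ + ∫ l, |g l - h l| ∂μ := by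
  have h1 : Integrable (fun l => |f l - g l|) μ := (hf.sub hg).abs
  have h2 : Integrable (fun l => |g l - h l|) μ := (hg.sub hh).abs
  rw [← integral_add h1 h2]
  exact integral_mono (hf.sub hh).abs (h1.add h2) fun l => abs_sub_le _ _ _

lemma integral_abs_sum_le {α : Type*} (s : Finset α) {f : α → Ω → ℝ}
    (hf : ∀ i ∈ s, Integrable (f i) μ) :
    ∫ l, |∑ i ∈ s, f i l| ∂μ ≤ ∑ i ∈ s, ∫ l, |f i l| ∂μ := by
  rw [← integral_finsetSum _ fun i hi => (hf i hi).abs]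
  exact integral_mono (integrable_finsetSum _ hf).abs
    (integrable_finsetSum _ fun i hi => (hf i hi).abs) fun l => Finset.abs_sum_le_sum_abs _ _

lemma ae_eq_of_integral_abs_sub_nonpos {f g : Ω → ℝ} (hf : Integrable f μ) (hg : Integrable g μ)
    (h : ∫ l, |f l - g l| ∂μ ≤ 0) : f =ᵐ[μ] g := by
  have h0 := (integral_eq_zero_iff_of_nonneg (fun l => abs_nonneg (f l - g l))
    (hf.sub hg).abs).1 (le_antisymm h (integral_nonneg fun l => abs_nonneg _))
  filter_upwards [h0] with l hl
  exact sub_eq_zero.1 (abs_eq_zero.1 hl)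

/-- Comparison of two block sums whose blocks are shifted against each other. -/
lemma integral_abs_block_sum_sub_le {L : ℕ} {m : Fin (L + 1) → ℕ} (hm : ∀ k, 0 < m k)
    {r : ℝ} (hr : 0 ≤ r) (hmr : ∀ k : Fin L, (m k.castSucc : ℝ) = r * m k.succ)
    {A B : (Σ k, Fin (m k)) → Ω → ℝ} (hA : ∀ x, Integrable (A x) μ)
    (hB : ∀ x, Integrable (B x) μ) {ε c c' : ℝ}
    (hAB : ∀ (k : Fin L) (s : Fin (m k.castSucc)) (t : Fin (m k.succ)),
      ∫ l, |A ⟨k.castSucc, s⟩ l - B ⟨k.succ, t⟩ l| ∂μ ≤ ε * (1 / ((L + 1) * m k.castSucc)))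
    (hlast : ∀ s : Fin (m (Fin.last L)),
      ∫ l, |A ⟨Fin.last L, s⟩ l| ∂μ ≤ c * (1 / ((L + 1) * m (Fin.last L))))
    (hfirst : ∀ t : Fin (m 0), ∫ l, |B ⟨0, t⟩ l| ∂μ ≤ c' * (1 / ((L + 1) * m 0)))
    (hε : 0 ≤ ε) :
    ∫ l, |∑ x, A x l - r * ∑ x, B x l| ∂μ ≤ ε + (c + r * c') / (L + 1) := by
  have hL : (0 : ℝ) < L + 1 := by positivity
  have hm' (k : Fin (L + 1)) : (0 : ℝ) < m k := by exact_mod_cast hm k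
  set a : Fin (L + 1) → Ω → ℝ := fun k l => ∑ s, A ⟨k, s⟩ l with ha
  set b : Fin (L + 1) → Ω → ℝ := fun k l => ∑ t, B ⟨k, t⟩ l with hb
  have ia (k) : Integrable (a k) μ := integrable_finsetSum _ fun s _ => hA _
  have ib (k) : Integrable (b k) μ := integrable_finsetSum _ fun s _ => hB _
  have hstep (k : Fin L) :
      ∫ l, |a k.castSucc l - r * b k.succ l| ∂μ ≤ ε / (L + 1) := by
    -- As the blocks have different sizes, all pairs of entries are compared and averaged; the ratio
    -- r of the block sizes appears as the factor of the second sum.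
    have hpt (l : Ω) : a k.castSucc l - r * b k.succ l =
        (m k.succ : ℝ)⁻¹ * ∑ p : Fin (m k.castSucc) × Fin (m k.succ),
          (A ⟨k.castSucc, p.1⟩ l - B ⟨k.succ, p.2⟩ l) := by
      have := (hm' k.succ).ne'
      rw [Finset.sum_sub_distrib, Fintype.sum_prod_type, Fintype.sum_prod_type]
      simp only [Finset.sum_const, Finset.card_univ, Fintype.card_fin, nsmul_eq_mul,
        ← Finset.mul_sum, hmr, ha, hb]
      field_simp
    simp_rw [hpt, abs_mul, abs_of_pos (inv_pos.2 (hm' k.succ))]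
    rw [integral_const_mul, inv_mul_le_iff₀ (hm' _)]
    refine (integral_abs_sum_le _ fun p _ => (hA _).sub (hB _)).trans ?_
    refine (Finset.sum_le_sum fun p _ => hAB k p.1 p.2).trans (le_of_eq ?_)
    have := (hm' k.castSucc).ne'
    simp only [Finset.sum_const, Finset.card_univ, Fintype.card_prod, Fintype.card_fin,
      nsmul_eq_mul]
    push_cast
    field_simp
  have hl : ∫ l, |a (Fin.last L) l| ∂μ ≤ c / (L + 1) := by
    refine (integral_abs_sum_le _ fun p _ => hA _).trans ?_
    refine (Finset.sum_le_sum fun p _ => hlast p).trans (le_of_eq ?_)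
    have := (hm' (Fin.last L)).ne'
    simp only [Finset.sum_const, Finset.card_univ, Fintype.card_fin, nsmul_eq_mul]
    field_simp
  have hf : ∫ l, |r * b 0 l| ∂μ ≤ r * (c' / (L + 1)) := by
    simp_rw [abs_mul, abs_of_nonneg hr]
    rw [integral_const_mul]
    refine mul_le_mul_of_nonneg_left ?_ hr
    refine (integral_abs_sum_le _ fun p _ => hB _).trans ?_
    refine (Finset.sum_le_sum fun p _ => hfirst p).trans (le_of_eq ?_)
    have := (hm' 0).ne'
    simp only [Finset.sum_const, Finset.card_univ, Fintype.card_fin, nsmul_eq_mul]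
    field_simp
  have hpt (l : Ω) : |∑ x, A x l - r * ∑ x, B x l| ≤
      |∑ k : Fin L, (a k.castSucc l - r * b k.succ l)| + (|a (Fin.last L) l| + |r * b 0 l|) := by
    -- The shift by one block leaves the last block of A and the first block of B without a partner.
    have e : ∑ x, A x l - r * ∑ x, B x l =
        ∑ k : Fin L, (a k.castSucc l - r * b k.succ l) + (a (Fin.last L) l - r * b 0 l) := by
      rw [Fintype.sum_sigma, Fintype.sum_sigma]
      change ∑ k, a k l - r * ∑ k, b k l = _
      rw [Fin.sum_univ_castSucc, Fin.sum_univ_succ, Finset.sum_sub_distrib, ← Finset.mul_sum]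
      ring
    rw [e]
    exact (abs_add_le _ _).trans (add_le_add le_rfl (abs_sub _ _))
  have id (k : Fin L) : Integrable (fun l => a k.castSucc l - r * b k.succ l) μ :=
    (ia _).sub ((ib _).const_mul r)
  have isum : Integrable (fun l => ∑ k : Fin L, (a k.castSucc l - r * b k.succ l)) μ :=
    integrable_finsetSum _ fun k _ => id k
  have ie : Integrable (fun l => |a (Fin.last L) l| + |r * b 0 l|) μ :=
    (ia _).abs.add ((ib _).const_mul r).abs
  have iA : Integrable (fun l => ∑ x, A x l) μ := integrable_finsetSum _ fun x _ => hA x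
  have iB : Integrable (fun l => ∑ x, B x l) μ := integrable_finsetSum _ fun x _ => hB x
  calc ∫ l, |∑ x, A x l - r * ∑ x, B x l| ∂μ
      ≤ ∫ l, (|∑ k : Fin L, (a k.castSucc l - r * b k.succ l)| +
          (|a (Fin.last L) l| + |r * b 0 l|)) ∂μ :=
        integral_mono (iA.sub (iB.const_mul r)).abs (isum.abs.add ie) hpt
    _ = ∫ l, |∑ k : Fin L, (a k.castSucc l - r * b k.succ l)| ∂μ +
          (∫ l, |a (Fin.last L) l| ∂μ + ∫ l, |r * b 0 l| ∂μ) := by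
        rw [integral_add isum.abs ie, integral_add (ia _).abs ((ib _).const_mul r).abs]
    _ ≤ ∑ k : Fin L, ε / (L + 1) + (c / (L + 1) + r * (c' / (L + 1))) :=
        add_le_add ((integral_abs_sum_le _ fun k _ => id k).trans
          (Finset.sum_le_sum fun k _ => hstep k)) (add_le_add hl hf)
    _ ≤ ε + (c + r * c') / (L + 1) := by
        have h1 : ∑ k : Fin L, ε / (L + 1) ≤ ε := by
          simp only [Finset.sum_const, Finset.card_univ, Fintype.card_fin, nsmul_eq_mul]
          rw [← mul_div_assoc, div_le_iff₀ hL]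
          nlinarith
        have h2 : c / (L + 1) + r * (c' / (L + 1)) = (c + r * c') / (L + 1) := by ring
        rw [h2]
        linarith

end L1

/-! ## Ontic models -/

lemma Procedures.exists_op_eq {S : QSys} (Q : Procedures.{u} S) {J : Finset S.parts} {X : S.Op}
    (hX : X ∈ S.localOps J) (h : X.IsHermitian) : ∃ M ∈ Q.loc J, Q.op M = X := by
  obtain ⟨A, hA, rfl⟩ := QSys.exists_isHermitian_of_mem_localOps hX h
  exact Q.loc_surj J A hA

namespace OnticModel

variable {S : QSys} {Q : Procedures.{u} S} (O : OnticModel.{u, v} Q)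

lemma measurable_resp (M : Q.Meas) (a : ℝ) : Measurable fun l => (O.resp M l).real {a} :=
  ((O.resp M).measurable_coe (measurableSet_singleton a)).ennreal_toReal

lemma resp_le_one (M : Q.Meas) (a : ℝ) (l : O.Λ) : (O.resp M l).real {a} ≤ 1 := by
  have := O.resp_markov M
  exact measureReal_le_one

lemma integrable_resp (ν : Measure O.Λ) [IsFiniteMeasure ν] (M : Q.Meas) (a : ℝ) :
    Integrable (fun l => (O.resp M l).real {a}) ν := by
  refine Integrable.of_bound (O.measurable_resp M a).aestronglyMeasurable 1
    (Filter.Eventually.of_forall fun l => ?_)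
  rw [Real.norm_of_nonneg measureReal_nonneg]
  exact O.resp_le_one M a l

lemma integrable_joint (ν : Measure O.Λ) [IsFiniteMeasure ν] {M N : Q.Meas}
    (h : Q.SepLocal M N) (p : ℝ × ℝ) : Integrable (fun l => (O.joint M N l).real {p}) ν := by
  have := O.joint_markov M N h
  refine Integrable.of_bound ((O.joint M N).measurable_coe
    (measurableSet_singleton p)).ennreal_toReal.aestronglyMeasurable 1
    (Filter.Eventually.of_forall fun l => ?_)
  rw [Real.norm_of_nonneg measureReal_nonneg]
  exact measureReal_le_one

variable {O}

lemma ParameterIndependent.sum_joint_le_left (hO : O.ParameterIndependent) {J : Finset S.parts}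
    {M N : Q.Meas} (hM : M ∈ Q.loc J) (hN : N ∈ Q.loc Jᶜ) (l : O.Λ) (a : ℝ) (Y : Finset ℝ) :
    ∑ b ∈ Y, (O.joint M N l).real {(a, b)} ≤ (O.resp M l).real {a} := by
  have := O.resp_markov M
  have := O.joint_markov M N ⟨J, hM, hN⟩
  simp only [measureReal_def]
  rw [← ENNReal.toReal_sum fun b _ => measure_ne_top _ _]
  refine ENNReal.toReal_mono (measure_ne_top _ _) ?_
  rw [(hO J M hM N hN l).1 a]
  exact ENNReal.sum_le_tsum Y

lemma ParameterIndependent.sum_joint_le_right (hO : O.ParameterIndependent) {J : Finset S.parts}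
    {M N : Q.Meas} (hM : M ∈ Q.loc J) (hN : N ∈ Q.loc Jᶜ) (l : O.Λ) (b : ℝ) (X : Finset ℝ) :
    ∑ a ∈ X, (O.joint M N l).real {(a, b)} ≤ (O.resp N l).real {b} := by
  have := O.resp_markov N
  have := O.joint_markov M N ⟨J, hM, hN⟩
  simp only [measureReal_def]
  rw [← ENNReal.toReal_sum fun b _ => measure_ne_top _ _]
  refine ENNReal.toReal_mono (measure_ne_top _ _) ?_
  rw [(hO J M hM N hN l).2 b]
  exact ENNReal.sum_le_tsum X

/-- The probabilities of two events on the two sides differ on average by at most the quantum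
mechanical probability that exactly one of them happens. -/
lemma ParameterIndependent.integral_abs_sub_le (hO : O.ParameterIndependent)
    {J : Finset S.parts} {M N : Q.Meas} (hM : M ∈ Q.loc J) (hN : N ∈ Q.loc Jᶜ) (P : Q.Prep)
    (X Y : Finset ℝ) :
    ∫ l, |∑ a ∈ X, (O.resp M l).real {a} - ∑ b ∈ Y, (O.resp N l).real {b}| ∂(O.μ P) ≤
      ∑ a ∈ X, born (Q.state P) (eigProj (Q.op M) a) +
        ∑ b ∈ Y, born (Q.state P) (eigProj (Q.op N) b) -
        2 * ∑ a ∈ X, ∑ b ∈ Y, born (Q.state P) (eigProj (Q.op M) a * eigProj (Q.op N) b) := by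
  have := O.μ_prob P
  have hMN : Q.SepLocal M N := ⟨J, hM, hN⟩
  have iM : Integrable (fun l => ∑ a ∈ X, (O.resp M l).real {a}) (O.μ P) :=
    integrable_finsetSum _ fun a _ => O.integrable_resp _ M a
  have iN : Integrable (fun l => ∑ b ∈ Y, (O.resp N l).real {b}) (O.μ P) :=
    integrable_finsetSum _ fun b _ => O.integrable_resp _ N b
  have iJ (a : ℝ) : Integrable (fun l => ∑ b ∈ Y, (O.joint M N l).real {(a, b)}) (O.μ P) :=
    integrable_finsetSum _ fun b _ => O.integrable_joint _ hMN (a, b)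
  have iJ' : Integrable (fun l => ∑ a ∈ X, ∑ b ∈ Y, (O.joint M N l).real {(a, b)}) (O.μ P) :=
    integrable_finsetSum _ fun a _ => iJ a
  -- For j ≤ p and j ≤ q one has |p − q| ≤ p + q − 2j; parameter independence makes the joint
  -- probability such a j.
  have hpt (l : O.Λ) :
      |∑ a ∈ X, (O.resp M l).real {a} - ∑ b ∈ Y, (O.resp N l).real {b}| ≤
        (∑ a ∈ X, (O.resp M l).real {a} + ∑ b ∈ Y, (O.resp N l).real {b}) -
          2 * ∑ a ∈ X, ∑ b ∈ Y, (O.joint M N l).real {(a, b)} := by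
    have h1 : ∑ a ∈ X, ∑ b ∈ Y, (O.joint M N l).real {(a, b)} ≤
        ∑ a ∈ X, (O.resp M l).real {a} :=
      Finset.sum_le_sum fun a _ => hO.sum_joint_le_left hM hN l a Y
    have h2 : ∑ a ∈ X, ∑ b ∈ Y, (O.joint M N l).real {(a, b)} ≤
        ∑ b ∈ Y, (O.resp N l).real {b} := by
      rw [Finset.sum_comm]
      exact Finset.sum_le_sum fun b _ => hO.sum_joint_le_right hM hN l b X
    rw [abs_le]
    constructor <;> linarith
  refine (integral_mono (iM.sub iN).abs ((iM.add iN).sub (iJ'.const_mul 2)) hpt).trans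
    (le_of_eq ?_)
  rw [integral_sub' (iM.add iN) (iJ'.const_mul 2), integral_add' iM iN, integral_const_mul,
    integral_finsetSum _ fun a _ => O.integrable_resp _ M a,
    integral_finsetSum _ fun b _ => O.integrable_resp _ N b,
    integral_finsetSum _ fun a _ => iJ a]
  simp only [integral_finsetSum _ fun b _ => O.integrable_joint _ hMN (_, b), O.resp_born,
    O.joint_born P M N hMN]

/-- The case of single outcomes of `ParameterIndependent.integral_abs_sub_le`. -/
lemma ParameterIndependent.integral_abs_sub_le_single (hO : O.ParameterIndependent)
    {J : Finset S.parts} {M N : Q.Meas} (hM : M ∈ Q.loc J) (hN : N ∈ Q.loc Jᶜ) (P : Q.Prep)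
    (a b : ℝ) :
    ∫ l, |(O.resp M l).real {a} - (O.resp N l).real {b}| ∂(O.μ P) ≤
      born (Q.state P) (eigProj (Q.op M) a) + born (Q.state P) (eigProj (Q.op N) b) -
        2 * born (Q.state P) (eigProj (Q.op M) a * eigProj (Q.op N) b) := by
  simpa using hO.integral_abs_sub_le hM hN P {a} {b}

open IsMatrixUnits

/-- A chain of measurements that interpolates between two vectors of a Schmidt basis. -/
lemma ParameterIndependent.integral_abs_sub_le_chain (hO : O.ParameterIndependent)
    {J : Finset S.parts} {ι : Type*} [Fintype ι] [DecidableEq ι] {E F : ι → ι → S.Op}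
    {γ : ι → ℝ} {P : Q.Prep} (h : IsSchmidt S J (Q.state P) E F γ) {N : Q.Meas}
    (hN : N ∈ Q.loc Jᶜ) {b : ι → ℝ} (hb : ∀ x, eigProj (Q.op N) (b x) = F x x)
    {x y : ι} (hxy : x ≠ y) {n : ℕ} (hn : 0 < n) :
    ∫ l, |(O.resp N l).real {b x} - (O.resp N l).real {b y}| ∂(O.μ P) ≤
      8 * n * (γ x - γ y) ^ 2 + 10 * γ x ^ 2 / n := by
  have := O.μ_prob P
  have hn' : (0 : ℝ) < n := by exact_mod_cast hn
  have rot_mem {L : Finset S.parts} {G : ι → ι → S.Op} (hG : ∀ x y, G x y ∈ S.localOps L)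
      (t : ℝ) : rot G x y t ∈ S.localOps L :=
    add_mem (add_mem (Submodule.smul_mem _ _ (hG _ _))
      (Submodule.smul_mem _ _ (add_mem (hG _ _) (hG _ _)))) (Submodule.smul_mem _ _ (hG _ _))
  choose A hA hAop using fun t => Q.exists_op_eq (rot_mem h.left_mem t)
    (h.left.isHermitian_rot x y t)
  choose B hB hBop using fun t => Q.exists_op_eq (rot_mem h.right_mem t)
    (h.right.isHermitian_rot x y t)
  have hAproj (t : ℝ) : eigProj (Q.op (A t)) 1 = rot E x y t := by
    rw [hAop]
    exact eigProj_one_of_isIdempotentElem (h.left.isHermitian_rot x y t)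
      (h.left.isIdempotentElem_rot hxy t)
  have hBproj (t : ℝ) : eigProj (Q.op (B t)) 1 = rot F x y t := by
    rw [hBop]
    exact eigProj_one_of_isIdempotentElem (h.right.isHermitian_rot x y t)
      (h.right.isIdempotentElem_rot hxy t)
  have hAB (s t : ℝ) :
      ∫ l, |(O.resp (A s) l).real {1} - (O.resp (B t) l).real {1}| ∂(O.μ P) ≤
        4 * γ x ^ 2 * (s - t) ^ 2 + 4 * (γ x - γ y) ^ 2 := by
    refine (hO.integral_abs_sub_le_single (hA s) (hB t) P 1 1).trans ?_
    rw [hAproj, hBproj]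
    exact h.born_rot_disagree_le hxy s t
  -- A quarter turn in n steps. Each step goes from A to B at the same angle and from B to A at the
  -- next one, so the mismatch of the coefficients is paid twice per step.
  set δ : ℝ := Real.pi / 2 / n with hδ
  have hchain (k : ℕ) :
      ∫ l, |(O.resp (A 0) l).real {1} - (O.resp (A (k * δ)) l).real {1}| ∂(O.μ P) ≤
        k * (4 * γ x ^ 2 * δ ^ 2 + 8 * (γ x - γ y) ^ 2) := by
    induction k with
    | zero => simp
    | succ k ih =>
      refine (integral_abs_sub_triangle (O.integrable_resp _ _ _)
        (O.integrable_resp _ (A (k * δ)) 1) (O.integrable_resp _ _ _)).trans ?_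
      have h1 := hAB (k * δ) (k * δ)
      have h2 := hAB ((k + 1 : ℕ) * δ) (k * δ)
      simp only [abs_sub_comm ((O.resp (A ((k + 1 : ℕ) * δ)) _).real {1})] at h2
      have h3 := integral_abs_sub_triangle (O.integrable_resp (O.μ P) (A (k * δ)) 1)
        (O.integrable_resp _ (B (k * δ)) 1) (O.integrable_resp _ (A ((k + 1 : ℕ) * δ)) 1)
      push_cast at h2 h3 ⊢
      linarith [show ((k + 1 : ℝ) * δ - k * δ) = δ by ring,
        show 4 * γ x ^ 2 * ((k + 1 : ℝ) * δ - k * δ) ^ 2 = 4 * γ x ^ 2 * δ ^ 2 by ring,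
        show 4 * γ x ^ 2 * ((k : ℝ) * δ - k * δ) ^ 2 = 0 by ring]
  -- At the two ends the rotated projection is a Schmidt projection, perfectly correlated with an
  -- outcome of N, so joining the chain to N costs nothing.
  have hend (t : ℝ) (z : ι) (ht : rot E x y t = E z z) :
      ∫ l, |(O.resp (A t) l).real {1} - (O.resp N l).real {b z}| ∂(O.μ P) ≤ 0 := by
    refine (hO.integral_abs_sub_le_single (hA t) hN P 1 (b z)).trans (le_of_eq ?_)
    rw [hAproj, hb, ht, h.born_left, h.born_right, h.born_diag_mul_diag]
    simp only [if_true]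
    ring
  have hnδ : n * δ = Real.pi / 2 := by
    rw [hδ]
    field_simp
  have h0 := hend 0 x (rot_zero E x y)
  have h1 := hend (n * δ) y (by rw [hnδ, rot_pi_div_two])
  simp only [abs_sub_comm ((O.resp (A 0) _).real {1})] at h0
  have h2 := integral_abs_sub_triangle (O.integrable_resp (O.μ P) N (b x))
    (O.integrable_resp _ (A 0) 1) (O.integrable_resp _ N (b y))
  have h3 := integral_abs_sub_triangle (O.integrable_resp (O.μ P) (A 0) 1)
    (O.integrable_resp _ (A (n * δ)) 1) (O.integrable_resp _ N (b y))
  have h4 : n * (4 * γ x ^ 2 * δ ^ 2 + 8 * (γ x - γ y) ^ 2) ≤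
      8 * n * (γ x - γ y) ^ 2 + 10 * γ x ^ 2 / n := by
    -- The rotation terms add up to 4γ_x² · n · (π/2n)² = π²γ_x²/n, hence the constant 10.
    have hpi : Real.pi ^ 2 ≤ 10 := by nlinarith [Real.pi_lt_d2, Real.pi_pos]
    have e : n * (4 * γ x ^ 2 * δ ^ 2 + 8 * (γ x - γ y) ^ 2) =
        8 * n * (γ x - γ y) ^ 2 + Real.pi ^ 2 * γ x ^ 2 / n := by
      rw [hδ]
      field_simp
      ring
    rw [e]
    gcongr
  linarith [hchain n]

end OnticModel

/-! ### Appending an entangled ancilla -/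

lemma integral_bind_kernel {α β : Type*} [MeasurableSpace α] [MeasurableSpace β] (μ : Measure α)
    [IsFiniteMeasure μ] (κ : Kernel α β) [IsMarkovKernel κ] {f : β → ℝ}
    (hf : Integrable f (μ.bind κ)) :
    Integrable (fun x => ∫ y, f y ∂κ x) μ ∧ ∫ y, f y ∂(μ.bind κ) = ∫ x, ∫ y, f y ∂κ x ∂μ := by
  have h : μ.bind κ = (κ ∘ₖ Kernel.const Unit μ) () := by
    rw [Kernel.comp_apply, Kernel.const_apply]
  rw [h] at hf ⊢
  exact ⟨by simpa using hf.integral_comp, by simpa using Kernel.integral_comp hf⟩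

/-- The spectral projections of `∑ i, a i • E i i` for matrix units `E`. -/
lemma IsMatrixUnits.eigProj_diag {n : Type} [Fintype n] [DecidableEq n] {ι : Type*} [Fintype ι]
    [DecidableEq ι] {E : ι → ι → Matrix n n ℂ} (hE : IsMatrixUnits E) (a : ι → ℝ) (x : ℝ) :
    eigProj (∑ i, (a i : ℂ) • E i i) x = ∑ i with a i = x, E i i :=
  eigProj_sum hE.isHermitian hE.mul_diag hE.sum a x

lemma IsMatrixUnits.eigProj_diag_of_injective {n : Type} [Fintype n] [DecidableEq n] {ι : Type*}
    [Fintype ι] [DecidableEq ι] {E : ι → ι → Matrix n n ℂ} (hE : IsMatrixUnits E) {a : ι → ℝ}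
    (ha : Function.Injective a) (i : ι) : eigProj (∑ i, (a i : ℂ) • E i i) (a i) = E i i := by
  rw [hE.eigProj_diag]
  simp [ha.eq_iff, Finset.filter_eq']

lemma IsMatrixUnits.isHermitian_diag {n : Type} [Fintype n] [DecidableEq n] {ι : Type*}
    [Fintype ι] [DecidableEq ι] {E : ι → ι → Matrix n n ℂ} (hE : IsMatrixUnits E) (a : ι → ℝ) :
    (∑ i, (a i : ℂ) • E i i).IsHermitian := by
  rw [Matrix.IsHermitian, Matrix.conjTranspose_sum]
  refine Finset.sum_congr rfl fun i _ => ?_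
  rw [Matrix.conjTranspose_smul, hE.conjTranspose, RCLike.star_def, Complex.conj_ofReal]

lemma exists_injective_real (ι : Type*) [Fintype ι] : ∃ b : ι → ℝ, Function.Injective b :=
  ⟨fun x => ((Fintype.equivFin ι x : ℕ) : ℝ), fun _ _ h =>
    (Fintype.equivFin ι).injective (Fin.val_injective (Nat.cast_injective h))⟩

/-- Bounds the chain error by a difference of squared coefficients, which scales linearly with the
weights of the ancilla and can be summed over its blocks. -/
lemma sq_sub_le_abs_sq_sub_sq {a b : ℝ} (ha : 0 ≤ a) (hb : 0 ≤ b) :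
    (a - b) ^ 2 ≤ |a ^ 2 - b ^ 2| := by
  rw [sq_sub_sq, abs_mul, abs_of_nonneg (add_nonneg ha hb), ← sq_abs, sq]
  exact mul_le_mul_of_nonneg_right (abs_sub_le_iff.2 ⟨by linarith, by linarith⟩) (abs_nonneg _)

section CompleteModel

variable {Q : ∀ S : QSys, Procedures.{u} S} {C : CompleteOnticModel.{u, v} Q}

/-- Appending an ancilla does not decrease the average differences of response probabilities. -/
lemma CompleteOnticModel.integral_abs_sub_append_le (C : CompleteOnticModel.{u, v} Q)
    {S R : QSys} {M : (Q S).Meas} {N : (Q (S.prod R)).Meas} {P₂ : (Q R).Prep}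
    (hN : ∀ (a : ℝ) (l : (C.model S).Λ), (C.model S).resp M l {a} =
      ∫⁻ k, (C.model (S.prod R)).resp N k {a} ∂(C.append S R P₂ l))
    {P₁ : (Q S).Prep} {P : (Q (S.prod R)).Prep}
    (hP : (C.model (S.prod R)).μ P = ((C.model S).μ P₁).bind (C.append S R P₂)) (a b r : ℝ) :
    ∫ l, |((C.model S).resp M l).real {a} - r * ((C.model S).resp M l).real {b}|
        ∂((C.model S).μ P₁) ≤
      ∫ l, |((C.model (S.prod R)).resp N l).real {a} -
        r * ((C.model (S.prod R)).resp N l).real {b}| ∂((C.model (S.prod R)).μ P) := by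
  have := (C.model S).μ_prob P₁
  have := (C.model (S.prod R)).μ_prob P
  have := C.append_markov S R P₂
  have := (C.model (S.prod R)).resp_markov N
  have hreal (a : ℝ) (l : (C.model S).Λ) : ((C.model S).resp M l).real {a} =
      ∫ k, ((C.model (S.prod R)).resp N k).real {a} ∂(C.append S R P₂ l) := by
    simp only [measureReal_def]
    rw [hN, integral_toReal (((C.model (S.prod R)).resp N).measurable_coe
      (measurableSet_singleton a)).aemeasurable
      (Filter.Eventually.of_forall fun k => measure_lt_top _ _)]
  have hint (ν : Measure (C.model (S.prod R)).Λ) [IsFiniteMeasure ν] :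
      Integrable (fun l => ((C.model (S.prod R)).resp N l).real {a} -
        r * ((C.model (S.prod R)).resp N l).real {b}) ν :=
    ((C.model (S.prod R)).integrable_resp ν N a).sub
      (((C.model (S.prod R)).integrable_resp ν N b).const_mul r)
  have hbind := (hint ((C.model (S.prod R)).μ P)).abs
  rw [hP] at hbind ⊢
  obtain ⟨hi, he⟩ := integral_bind_kernel _ _ hbind
  rw [he]
  refine integral_mono (((C.model S).integrable_resp _ M a).sub
    (((C.model S).integrable_resp _ M b).const_mul r)).abs hi fun l => ?_
  -- Responses on S are averages of responses on the joint system, so the triangle inequality for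
  -- integrals applies at each ontic state.
  change |_ - _| ≤ _
  rw [hreal, hreal, ← integral_const_mul,
    ← integral_sub ((C.model (S.prod R)).integrable_resp _ N a)
      (((C.model (S.prod R)).integrable_resp _ N b).const_mul r)]
  exact abs_integral_le_integral_abs

section Main

variable {S : QSys} {J : Finset S.parts} {ι : Type*} [Fintype ι] [DecidableEq ι]
  {E F : ι → ι → S.Op} {γ : ι → ℝ} {P : (Q S).Prep}

/-- The first summand is the error of the chains between matched blocks, the second the weight of
the unmatched outer blocks. A rational ratio p/q allows integer block sizes in exact geometric
progression. -/
lemma CompleteOnticModel.integral_abs_sub_le_of_ancilla (hAI : C.AncillaIndependent)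
    (hPI : C.ParameterIndependent) (h : IsSchmidt S J ((Q S).state P) E F γ)
    {M : (Q S).Meas} (hM : M ∈ (Q S).loc J) {a : ι → ℝ} (ha : Function.Injective a)
    (hMop : (Q S).op M = ∑ i, (a i : ℂ) • E i i) {i j : ι} (hij : i ≠ j) {p q : ℕ} (hp : 0 < p)
    (hq : 0 < q) {n : ℕ} (hn : 0 < n) (L : ℕ) :
    ∫ l, |((C.model S).resp M l).real {a i} - (p / q : ℝ) * ((C.model S).resp M l).real {a j}|
        ∂((C.model S).μ P) ≤
      (8 * n * |γ i ^ 2 - p / q * γ j ^ 2| + 10 * γ i ^ 2 / n) +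
        (γ i ^ 2 + p / q * γ j ^ 2) / (L + 1) := by
  set r : ℝ := p / q with hr
  have hp' : (0 : ℝ) < p := by exact_mod_cast hp
  have hq' : (0 : ℝ) < q := by exact_mod_cast hq
  have hr0 : 0 < r := div_pos hp' hq'
  have hn' : (0 : ℝ) < n := by exact_mod_cast hn
  -- the ancilla
  let m : Fin (L + 1) → ℕ := fun k => q ^ (k : ℕ) * p ^ (L - k)
  have hm (k) : 0 < m k := by positivity
  have hm' (k) : (0 : ℝ) < m k := by exact_mod_cast hm k
  have hmr (k : Fin L) : (m k.castSucc : ℝ) = r * m k.succ := by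
    have hk : L - (k : ℕ) = (L - (k + 1)) + 1 := by omega
    simp only [m, Fin.val_castSucc, Fin.val_succ, hr, hk]
    push_cast
    field_simp
    ring
  -- Normalised so that every block has total weight 1/(L + 1); the weights then grow by r as the
  -- sizes shrink by r.
  let w : Fin (L + 1) → ℝ := fun k => 1 / ((L + 1) * m k)
  have hw (k) : 0 ≤ w k := by positivity
  have hwr (k : Fin L) : w k.succ = r * w k.castSucc := by
    have h1 := (hm' k.succ).ne'
    simp only [w, hmr]
    field_simp
  obtain ⟨γ', hγ'0, hγ'sq⟩ : ∃ γ' : (Σ k, Fin (m k)) → ℝ,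
      (∀ x, 0 ≤ γ' x) ∧ ∀ x, γ' x ^ 2 = w x.1 :=
    ⟨fun x => √(w x.1), fun x => Real.sqrt_nonneg _, fun x => Real.sq_sqrt (hw _)⟩
  have hγ'sum : ∑ x, γ' x ^ 2 = 1 := by
    simp only [hγ'sq]
    rw [Fintype.sum_sigma]
    simp only [Finset.sum_const, Finset.card_univ, Fintype.card_fin, nsmul_eq_mul, w]
    have hmw (k) : (m k : ℝ) * (1 / ((L + 1) * m k)) = 1 / (L + 1) := by
      have := (hm' k).ne'
      field_simp
    simp only [hmw, Finset.sum_const, Finset.card_univ, Fintype.card_fin, nsmul_eq_mul]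
    push_cast
    field_simp
  obtain ⟨R, K, σ, E', F', hσ, h'⟩ := exists_isSchmidt hγ'0 hγ'sum
  obtain ⟨P₂, rfl⟩ := (Q R).state_surj σ hσ
  obtain ⟨P', hP'μ, hP'⟩ := C.append_prep S R P₂ P
  obtain ⟨M', hM'op, hM'loc, hM'⟩ := hAI S R M
  set O := C.model (S.prod R)
  have hOPI : O.ParameterIndependent := hPI (S.prod R)
  have := O.μ_prob P'
  refine (C.integral_abs_sub_append_le (hM' P₂) hP'μ (a i) (a j) r).trans ?_
  have hs := h.prod h'
  rw [← hP'] at hs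
  -- Half of the ancilla is counted to the first side, where M' ignores it; its partner N on the
  -- other side may then resolve the ancilla's Schmidt basis.
  have hM'J : M' ∈ (Q (S.prod R)).loc (J.disjSum K) := by
    refine (Q (S.prod R)).loc_mono _ _ ?_ (hM'loc J hM)
    intro x hx
    obtain ⟨y, hy, rfl⟩ := Finset.mem_map.1 hx
    exact Finset.inl_mem_disjSum.2 hy
  -- a complete measurement on the other side
  obtain ⟨b, hb⟩ := exists_injective_real (ι × Σ k, Fin (m k))
  obtain ⟨N, hN, hNop⟩ := (Q (S.prod R)).exists_op_eq
    (Submodule.sum_mem _ fun x _ => Submodule.smul_mem _ (b x : ℂ) (hs.right_mem x x))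
    (hs.right.isHermitian_diag b)
  have hNproj (x) : eigProj ((Q (S.prod R)).op N) (b x) =
      QSys.prodOp (F x.1 x.1) (F' x.2 x.2) := by
    rw [hNop]
    exact hs.right.eigProj_diag_of_injective hb x
  have hM'proj (i : ι) : eigProj ((Q (S.prod R)).op M') (a i) =
      ∑ y, QSys.prodOp (E i i) (E' y y) := by
    have e : (Q (S.prod R)).op M' =
        ∑ x : ι × Σ k, Fin (m k), (a x.1 : ℂ) • QSys.prodOp (E x.1 x.1) (E' x.2 x.2) := by
      rw [hM'op, hMop, ← QSys.sum_prodOp, Fintype.sum_prod_type]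
      refine Finset.sum_congr rfl fun i _ => ?_
      change _ = ∑ y, (a i : ℂ) • QSys.prodOp (E i i) (E' y y)
      rw [QSys.smul_prodOp, ← Finset.smul_sum, QSys.prodOp_sum, h'.left.sum]
    rw [e, hs.left.eigProj_diag (fun x => a x.1) (a i), Finset.sum_filter,
      Fintype.sum_prod_type]
    simp only [ha.eq_iff]
    rw [Finset.sum_eq_single i]
    · simp
    · intro k _ hk
      simp [hk]
    · simp
  let g : ι × (Σ k, Fin (m k)) → O.Λ → ℝ := fun x l => (O.resp N l).real {b x}
  have hg (x) : Integrable (g x) (O.μ P') := O.integrable_resp _ N (b x)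
  have hgsum (i) : Integrable (fun l => ∑ y, g (i, y) l) (O.μ P') :=
    integrable_finsetSum _ fun y _ => hg _
  -- M' finds i exactly when N finds some (i, y), so the two response probabilities agree almost
  -- surely. The chains, which compare outcomes of N, thereby inform about M'.
  have hcoarse (i : ι) : (fun l => (O.resp M' l).real {a i}) =ᵐ[O.μ P']
      fun l => ∑ y, g (i, y) l := by
    refine ae_eq_of_integral_abs_sub_nonpos (O.integrable_resp _ _ _) (hgsum i) ?_
    have hinj : Function.Injective fun y => b (i, y) := fun y z hyz => by
      simpa using hb hyz
    have h1 := hOPI.integral_abs_sub_le hM'J hN P' {a i}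
      (Finset.univ.map ⟨fun y => b (i, y), hinj⟩)
    simp only [Finset.sum_singleton, Finset.sum_map, Function.Embedding.coeFn_mk, hNproj,
      hM'proj] at h1
    refine h1.trans (le_of_eq ?_)
    have e1 : born ((Q (S.prod R)).state P') (∑ y, QSys.prodOp (E i i) (E' y y)) =
        ∑ y, (γ i * γ' y) ^ 2 := by
      rw [born_sum]
      exact Finset.sum_congr rfl fun y _ => (hs.born_left (i, y) (i, y)).trans (if_pos rfl)
    have e2 : ∑ y, born ((Q (S.prod R)).state P') (QSys.prodOp (F i i) (F' y y)) =
        ∑ y, (γ i * γ' y) ^ 2 :=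
      Finset.sum_congr rfl fun y _ => (hs.born_right (i, y) (i, y)).trans (if_pos rfl)
    have e3 (y) : born ((Q (S.prod R)).state P') ((∑ z, QSys.prodOp (E i i) (E' z z)) *
        QSys.prodOp (F i i) (F' y y)) = (γ i * γ' y) ^ 2 := by
      rw [Finset.sum_mul, born_sum, Finset.sum_eq_single y]
      · exact (hs.born_diag_mul_diag (i, y) (i, y)).trans (if_pos rfl)
      · intro z _ hz
        exact (hs.born_diag_mul_diag (i, z) (i, y)).trans (if_neg (by simpa using hz))
      · simp
    rw [e1, e2]
    simp only [e3]
    ring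
  have hgborn (x) : ∫ l, |g x l| ∂(O.μ P') = γ x.1 ^ 2 * w x.2.1 := by
    simp only [g, abs_of_nonneg measureReal_nonneg]
    rw [O.resp_born, hNproj]
    refine (hs.born_right x x).trans ?_
    rw [if_pos rfl, mul_pow, hγ'sq]
  have hcongr : ∫ l, |(O.resp M' l).real {a i} - r * (O.resp M' l).real {a j}| ∂(O.μ P') =
      ∫ l, |∑ y, g (i, y) l - r * ∑ y, g (j, y) l| ∂(O.μ P') := by
    refine integral_congr_ae ?_
    filter_upwards [hcoarse i, hcoarse j] with l h1 h2
    rw [h1, h2]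
  rw [hcongr]
  refine integral_abs_block_sum_sub_le hm hr0.le hmr (fun y => hg (i, y)) (fun y => hg (j, y))
    (fun k s t => ?_) (fun s => (hgborn _).le) (fun t => (hgborn _).le) (by positivity)
  have hne : ((i, ⟨k.castSucc, s⟩) : ι × Σ k, Fin (m k)) ≠ (j, ⟨k.succ, t⟩) := fun h =>
    hij (congrArg Prod.fst h)
  refine (hOPI.integral_abs_sub_le_chain hs hN hNproj hne hn).trans ?_
  have h1 := sq_sub_le_abs_sq_sub_sq (hs.nonneg (i, ⟨k.castSucc, s⟩)) (hs.nonneg (j, ⟨k.succ, t⟩))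
  simp only [mul_pow, hγ'sq, hwr] at h1 ⊢
  -- The shift by one block turns the mismatch of the coefficients into γ_i² − rγ_j², up to the
  -- common weight.
  have h2 : γ i ^ 2 * w k.castSucc - γ j ^ 2 * (r * w k.castSucc) =
      (γ i ^ 2 - r * γ j ^ 2) * w k.castSucc := by ring
  rw [h2, abs_mul, abs_of_nonneg (hw _)] at h1
  calc _ ≤ 8 * n * (|γ i ^ 2 - r * γ j ^ 2| * w k.castSucc) +
        10 * (γ i ^ 2 * w k.castSucc) / n := by gcongr
    _ = (8 * n * |γ i ^ 2 - r * γ j ^ 2| + 10 * γ i ^ 2 / n) * w k.castSucc := by ring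

end Main

end CompleteModel

/-! ### From Schmidt coefficients to trivial response probabilities -/

section Diag

variable {S : QSys} {J : Finset S.parts} {ρ : S.Op} {ι : Type*} [Fintype ι] [DecidableEq ι]
  {E F : ι → ι → S.Op} {γ : ι → ℝ}

lemma IsSchmidt.born_eigProj_left (h : IsSchmidt S J ρ E F γ) (a : ι → ℝ) (x : ℝ) :
    born ρ (eigProj (∑ i, (a i : ℂ) • E i i) x) = ∑ i with a i = x, γ i ^ 2 := by
  rw [h.left.eigProj_diag, born_sum]
  simp [h.born_left]

lemma IsSchmidt.born_eigProj_right (h : IsSchmidt S J ρ E F γ) (b : ι → ℝ) (y : ℝ) :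
    born ρ (eigProj (∑ i, (b i : ℂ) • F i i) y) = ∑ i with b i = y, γ i ^ 2 := by
  rw [h.right.eigProj_diag, born_sum]
  simp [h.born_right]

lemma IsSchmidt.born_eigProj_mul_eigProj (h : IsSchmidt S J ρ E F γ) (a b : ι → ℝ) (x y : ℝ) :
    born ρ (eigProj (∑ i, (a i : ℂ) • E i i) x * eigProj (∑ i, (b i : ℂ) • F i i) y) =
      ∑ i with a i = x ∧ b i = y, γ i ^ 2 := by
  rw [h.left.eigProj_diag, h.right.eigProj_diag, Finset.sum_mul_sum, born_sum,
    Finset.sum_filter, Finset.sum_filter]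
  refine Finset.sum_congr rfl fun i _ => ?_
  rw [born_sum]
  simp only [h.born_diag_mul_diag, Finset.sum_ite_eq, Finset.mem_filter, Finset.mem_univ,
    true_and, ite_and]

end Diag

section Triviality

variable {Q : ∀ S : QSys, Procedures.{u} S} {C : CompleteOnticModel.{u, v} Q}
  {S : QSys} {J : Finset S.parts} {ι : Type*} [Fintype ι] [DecidableEq ι]
  {E F : ι → ι → S.Op} {γ : ι → ℝ} {P : (Q S).Prep}

/-- The order of the limits matters: L → ∞ removes the outer blocks, then p/q → γ_i²/γ_j² at fixed n
removes the mismatch, which carries a factor n, and finally n → ∞ removes the rotation error. -/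
lemma CompleteOnticModel.resp_proportional (hAI : C.AncillaIndependent)
    (hPI : C.ParameterIndependent) (h : IsSchmidt S J ((Q S).state P) E F γ)
    {M : (Q S).Meas} (hM : M ∈ (Q S).loc J) {a : ι → ℝ} (ha : Function.Injective a)
    (hMop : (Q S).op M = ∑ i, (a i : ℂ) • E i i) {i j : ι} (hij : i ≠ j) (hi : 0 < γ i)
    (hj : 0 < γ j) :
    ∀ᵐ l ∂((C.model S).μ P), γ j ^ 2 * ((C.model S).resp M l).real {a i} =
      γ i ^ 2 * ((C.model S).resp M l).real {a j} := by
  set O := C.model S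
  have := O.μ_prob P
  have hj2 : 0 < γ j ^ 2 := by positivity
  set r₀ : ℝ := γ i ^ 2 / γ j ^ 2 with hr₀
  have hr₀pos : 0 < r₀ := by positivity
  have hint (r : ℝ) : Integrable (fun l => |(O.resp M l).real {a i} -
      r * (O.resp M l).real {a j}|) (O.μ P) :=
    ((O.integrable_resp _ M _).sub ((O.integrable_resp _ M _).const_mul r)).abs
  -- the limit of many ancilla levels
  have h1 (p q n : ℕ) (hp : 0 < p) (hq : 0 < q) (hn : 0 < n) :
      ∫ l, |(O.resp M l).real {a i} - (p / q : ℝ) * (O.resp M l).real {a j}| ∂(O.μ P) ≤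
        8 * n * |γ i ^ 2 - p / q * γ j ^ 2| + 10 * γ i ^ 2 / n := by
    have ht : Filter.Tendsto (fun L : ℕ => (8 * n * |γ i ^ 2 - p / q * γ j ^ 2| +
        10 * γ i ^ 2 / n) + (γ i ^ 2 + p / q * γ j ^ 2) * (1 / ((L : ℝ) + 1))) Filter.atTop
        (nhds ((8 * n * |γ i ^ 2 - p / q * γ j ^ 2| + 10 * γ i ^ 2 / n) +
          (γ i ^ 2 + p / q * γ j ^ 2) * 0)) :=
      (tendsto_one_div_add_atTop_nhds_zero_nat.const_mul _).const_add _
    rw [mul_zero, add_zero] at ht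
    refine ge_of_tendsto' ht fun L => ?_
    rw [mul_one_div]
    exact C.integral_abs_sub_le_of_ancilla hAI hPI h hM ha hMop hij hp hq hn L
  -- the limit of rational approximations
  have h2 (n : ℕ) (hn : 0 < n) :
      ∫ l, |(O.resp M l).real {a i} - r₀ * (O.resp M l).real {a j}| ∂(O.μ P) ≤
        10 * γ i ^ 2 * (1 / n) := by
    refine le_of_forall_pos_le_add fun ε hε => ?_
    -- Chosen so that the mismatch error 8nδγ_j² and the error δ of replacing r₀ by s add up to ε.
    set δ : ℝ := ε / (8 * n * γ j ^ 2 + 1) with hδ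
    have hδpos : 0 < δ := by positivity
    obtain ⟨s, hs1, hs2⟩ := exists_rat_btwn (lt_add_of_pos_right r₀ hδpos)
    have hs0 : 0 < s := by exact_mod_cast hr₀pos.trans hs1
    have hsnum : ((s.num.toNat : ℕ) : ℝ) / (s.den : ℝ) = s := by
      have e : ((s.num.toNat : ℕ) : ℤ) = s.num := Int.toNat_of_nonneg (Rat.num_pos.2 hs0).le
      rw [← Int.cast_natCast, e, Rat.cast_def]
    have h3 := h1 s.num.toNat s.den n (by have := Rat.num_pos.2 hs0; omega) s.den_pos hn
    rw [hsnum] at h3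
    have h4 : |γ i ^ 2 - s * γ j ^ 2| ≤ δ * γ j ^ 2 := by
      have e : γ i ^ 2 = r₀ * γ j ^ 2 := by
        rw [hr₀]
        field_simp
      rw [e, ← sub_mul, abs_mul, abs_of_pos hj2]
      exact mul_le_mul_of_nonneg_right (abs_le.2 ⟨by linarith, by linarith⟩) hj2.le
    have h5 : ∫ l, |(O.resp M l).real {a i} - r₀ * (O.resp M l).real {a j}| ∂(O.μ P) ≤
        ∫ l, |(O.resp M l).real {a i} - s * (O.resp M l).real {a j}| ∂(O.μ P) + δ := by
      have e : ∫ _, δ ∂(O.μ P) = δ := by simp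
      rw [← e, ← integral_add (hint s) (integrable_const δ)]
      refine integral_mono (hint r₀) ((hint s).add (integrable_const δ)) fun l => ?_
      have h6 : |(O.resp M l).real {a i} - r₀ * (O.resp M l).real {a j}| ≤
          |(O.resp M l).real {a i} - s * (O.resp M l).real {a j}| +
            |s * (O.resp M l).real {a j} - r₀ * (O.resp M l).real {a j}| := abs_sub_le _ _ _
      refine h6.trans (add_le_add le_rfl ?_)
      rw [← sub_mul, abs_mul, abs_of_nonneg (measureReal_nonneg), abs_of_pos (sub_pos.2 hs1)]
      have h7 := O.resp_le_one M (a j) l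
      have h8 : s - r₀ ≤ δ := by linarith
      calc (s - r₀) * (O.resp M l).real {a j} ≤ δ * 1 :=
            mul_le_mul h8 h7 measureReal_nonneg hδpos.le
        _ = δ := mul_one δ
    have h6 : 8 * n * |γ i ^ 2 - s * γ j ^ 2| ≤ 8 * n * (δ * γ j ^ 2) := by gcongr
    have h7 : 8 * n * (δ * γ j ^ 2) + δ = ε := by
      rw [hδ]
      field_simp
    have h8 : 10 * γ i ^ 2 / n = 10 * γ i ^ 2 * (1 / n) := by ring
    linarith
  -- the limit of long chains
  have h3 : ∫ l, |(O.resp M l).real {a i} - r₀ * (O.resp M l).real {a j}| ∂(O.μ P) ≤ 0 := by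
    have ht : Filter.Tendsto (fun n : ℕ => 10 * γ i ^ 2 * (1 / ((n : ℝ) + 1))) Filter.atTop
        (nhds (10 * γ i ^ 2 * 0)) := tendsto_one_div_add_atTop_nhds_zero_nat.const_mul _
    rw [mul_zero] at ht
    refine ge_of_tendsto' ht fun n => ?_
    exact_mod_cast h2 (n + 1) n.succ_pos
  filter_upwards [ae_eq_of_integral_abs_sub_nonpos (O.integrable_resp _ M _)
    ((O.integrable_resp _ M _).const_mul r₀) h3] with l hl
  rw [hl, hr₀]
  field_simp

/-- The response probabilities of a complete measurement in a Schmidt basis. -/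
lemma CompleteOnticModel.resp_eq_of_injective (hAI : C.AncillaIndependent)
    (hPI : C.ParameterIndependent) (h : IsSchmidt S J ((Q S).state P) E F γ)
    {M : (Q S).Meas} (hM : M ∈ (Q S).loc J) {a : ι → ℝ} (ha : Function.Injective a)
    (hMop : (Q S).op M = ∑ i, (a i : ℂ) • E i i) (i : ι) :
    ∀ᵐ l ∂((C.model S).μ P), ((C.model S).resp M l).real {a i} = γ i ^ 2 := by
  set O := C.model S
  have := O.μ_prob P
  have hsum : ∑ i, γ i ^ 2 = 1 := by
    exact_mod_cast h.trace_eq.symm.trans ((Q S).state_density P).2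
  have hborn (i) : ∫ l, (O.resp M l).real {a i} ∂(O.μ P) = γ i ^ 2 := by
    rw [O.resp_born, hMop, h.left.eigProj_diag_of_injective ha, h.born_left, if_pos rfl]
  have hzero (i) (hi : γ i = 0) : ∀ᵐ l ∂(O.μ P), (O.resp M l).real {a i} = 0 := by
    have h0 := (integral_eq_zero_iff_of_nonneg
      (fun l => (measureReal_nonneg : 0 ≤ (O.resp M l).real {a i}))
      (O.integrable_resp (O.μ P) M (a i))).1 (by rw [hborn, hi]; simp)
    filter_upwards [h0] with l hl using hl
  have hprop (j) : ∀ᵐ l ∂(O.μ P), γ j ^ 2 * (O.resp M l).real {a i} =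
      γ i ^ 2 * (O.resp M l).real {a j} := by
    -- If one of the coefficients vanishes, so does the corresponding response almost surely, and
    -- both sides are zero.
    by_cases hij : i = j
    · subst hij
      exact Filter.Eventually.of_forall fun _ => rfl
    rcases (h.nonneg i).eq_or_lt with hi | hi
    · filter_upwards [hzero i hi.symm] with l hl
      rw [hl, ← hi]
      ring
    rcases (h.nonneg j).eq_or_lt with hj | hj
    · filter_upwards [hzero j hj.symm] with l hl
      rw [hl, ← hj]
      ring
    exact C.resp_proportional hAI hPI h hM ha hMop hij hi hj
  -- The sum is at most 1 at each ontic state and has average Σ γ_j² = 1, so it is 1 almost surely.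
  have hone : (fun l => ∑ j, (O.resp M l).real {a j}) =ᵐ[O.μ P] fun _ => 1 := by
    have hi : Integrable (fun l => ∑ j, (O.resp M l).real {a j}) (O.μ P) :=
      integrable_finsetSum _ fun j _ => O.integrable_resp _ M _
    refine ae_eq_of_integral_abs_sub_nonpos hi (integrable_const 1) (le_of_eq ?_)
    have hle (l) : ∑ j, (O.resp M l).real {a j} ≤ 1 := by
      have := O.resp_markov M
      rw [← measureReal_biUnion_finset (fun j _ k _ hjk => by
        simpa using fun hh => hjk (ha hh)) (fun j _ => measurableSet_singleton _)]
      exact measureReal_le_one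
    simp_rw [abs_sub_comm _ (1 : ℝ), fun l => abs_of_nonneg (sub_nonneg.2 (hle l))]
    rw [integral_sub (integrable_const 1) hi,
      integral_finsetSum _ fun j _ => O.integrable_resp _ M _]
    simp [hborn, hsum]
  filter_upwards [Filter.eventually_all.2 hprop, hone] with l hl h1
  calc (O.resp M l).real {a i} = ∑ j, γ j ^ 2 * (O.resp M l).real {a i} := by
        rw [← Finset.sum_mul, hsum, one_mul]
    _ = γ i ^ 2 := by
        rw [Finset.sum_congr rfl fun j _ => hl j, ← Finset.mul_sum, h1, mul_one]

/-- A measurement on the first side has the same response probabilities as the corresponding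
coarse-graining of a complete measurement on the second side. -/
lemma OnticModel.ParameterIndependent.resp_left_eq_sum {O : OnticModel.{u, v} (Q S)}
    (hO : O.ParameterIndependent) (h : IsSchmidt S J ((Q S).state P) E F γ)
    {M N : (Q S).Meas} (hM : M ∈ (Q S).loc J) (hN : N ∈ (Q S).loc Jᶜ) {a b : ι → ℝ}
    (hMop : (Q S).op M = ∑ i, (a i : ℂ) • E i i) (hb : Function.Injective b)
    (hNop : (Q S).op N = ∑ i, (b i : ℂ) • F i i) (x : ℝ) :
    ∀ᵐ l ∂(O.μ P), (O.resp M l).real {x} = ∑ i with a i = x, (O.resp N l).real {b i} := by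
  have := O.μ_prob P
  refine ae_eq_of_integral_abs_sub_nonpos (O.integrable_resp _ M _)
    (integrable_finsetSum _ fun i _ => O.integrable_resp _ N _) ?_
  -- The outcome x on the left corresponds to the set of outcomes b i with a i = x on the right; the
  -- two events coincide with quantum probability one.
  have h1 := hO.integral_abs_sub_le hM hN P {x} (({i | a i = x} : Finset ι).map ⟨b, hb⟩)
  simp only [Finset.sum_singleton, Finset.sum_map, Function.Embedding.coeFn_mk, hMop, hNop,
    h.born_eigProj_left, h.born_eigProj_right, h.born_eigProj_mul_eigProj, hb.eq_iff] at h1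
  refine h1.trans (le_of_eq ?_)
  have e (i : ι) (hi : i ∈ ({i | a i = x} : Finset ι)) :
      ∑ k with a k = x ∧ k = i, γ k ^ 2 = γ i ^ 2 := by
    rw [Finset.sum_filter, Finset.sum_eq_single i]
    · simp [(Finset.mem_filter.1 hi).2]
    · intro k _ hk
      simp [hk]
    · simp
  rw [Finset.sum_congr rfl e]
  simp only [Finset.filter_eq', Finset.mem_univ, if_true, Finset.sum_singleton]
  ring

/-- A measurement on the second side has the same response probabilities as the corresponding
coarse-graining of a complete measurement on the first side. -/
lemma OnticModel.ParameterIndependent.resp_right_eq_sum {O : OnticModel.{u, v} (Q S)}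
    (hO : O.ParameterIndependent) (h : IsSchmidt S J ((Q S).state P) E F γ)
    {M N : (Q S).Meas} (hM : M ∈ (Q S).loc J) (hN : N ∈ (Q S).loc Jᶜ) {a b : ι → ℝ}
    (hMop : (Q S).op M = ∑ i, (a i : ℂ) • E i i) (ha : Function.Injective a)
    (hNop : (Q S).op N = ∑ i, (b i : ℂ) • F i i) (y : ℝ) :
    ∀ᵐ l ∂(O.μ P), (O.resp N l).real {y} = ∑ i with b i = y, (O.resp M l).real {a i} := by
  have := O.μ_prob P
  refine ae_eq_of_integral_abs_sub_nonpos (O.integrable_resp _ N _)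
    (integrable_finsetSum _ fun i _ => O.integrable_resp _ M _) ?_
  have h1 := hO.integral_abs_sub_le hM hN P (({i | b i = y} : Finset ι).map ⟨a, ha⟩) {y}
  simp only [Finset.sum_singleton, Finset.sum_map, Function.Embedding.coeFn_mk, hMop, hNop,
    h.born_eigProj_left, h.born_eigProj_right, h.born_eigProj_mul_eigProj, ha.eq_iff] at h1
  simp only [abs_sub_comm ((O.resp N _).real {y})]
  refine h1.trans (le_of_eq ?_)
  have e (i : ι) (hi : i ∈ ({i | b i = y} : Finset ι)) :
      ∑ k with k = i ∧ b k = y, γ k ^ 2 = γ i ^ 2 := by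
    rw [Finset.sum_filter, Finset.sum_eq_single i]
    · simp [(Finset.mem_filter.1 hi).2]
    · intro k _ hk
      simp [hk]
    · simp
  rw [Finset.sum_congr rfl e]
  simp only [Finset.filter_eq', Finset.mem_univ, if_true, Finset.sum_singleton]
  ring

lemma Procedures.exists_complete (Q : Procedures.{u} S) {L : Finset S.parts}
    {G : ι → ι → S.Op} (hG : IsMatrixUnits G) (hGL : ∀ x y, G x y ∈ S.localOps L) :
    ∃ (M : Q.Meas) (a : ι → ℝ), M ∈ Q.loc L ∧ Function.Injective a ∧
      Q.op M = ∑ i, (a i : ℂ) • G i i := by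
  obtain ⟨a, ha⟩ := exists_injective_real ι
  obtain ⟨M, hM, hop⟩ := Q.exists_op_eq
    (Submodule.sum_mem _ fun x _ => Submodule.smul_mem _ (a x : ℂ) (hGL x x))
    (hG.isHermitian_diag a)
  exact ⟨M, a, hM, ha, hop⟩

lemma CompleteOnticModel.resp_right_eq_born (hAI : C.AncillaIndependent)
    (hPI : C.ParameterIndependent) (h : IsSchmidt S J ((Q S).state P) E F γ)
    {N : (Q S).Meas} (hN : N ∈ (Q S).loc Jᶜ) {b : ι → ℝ}
    (hNop : (Q S).op N = ∑ i, (b i : ℂ) • F i i) (y : ℝ) :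
    ∀ᵐ l ∂((C.model S).μ P), ((C.model S).resp N l).real {y} =
      born ((Q S).state P) (eigProj ((Q S).op N) y) := by
  obtain ⟨M, a, hM, ha, hMop⟩ := (Q S).exists_complete h.left h.left_mem
  filter_upwards [(hPI S).resp_right_eq_sum h hM hN hMop ha hNop y,
    Filter.eventually_all.2 (C.resp_eq_of_injective hAI hPI h hM ha hMop)] with l h1 h2
  rw [h1, hNop, h.born_eigProj_right]
  exact Finset.sum_congr rfl fun i _ => h2 i

/-- The detour through the second side handles degenerate measurements: M is compared with a
non-degenerate N, whose responses are already known. -/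
lemma CompleteOnticModel.resp_left_eq_born (hAI : C.AncillaIndependent)
    (hPI : C.ParameterIndependent) (h : IsSchmidt S J ((Q S).state P) E F γ)
    {M : (Q S).Meas} (hM : M ∈ (Q S).loc J) {a : ι → ℝ}
    (hMop : (Q S).op M = ∑ i, (a i : ℂ) • E i i) (x : ℝ) :
    ∀ᵐ l ∂((C.model S).μ P), ((C.model S).resp M l).real {x} =
      born ((Q S).state P) (eigProj ((Q S).op M) x) := by
  obtain ⟨N, b, hN, hb, hNop⟩ := (Q S).exists_complete h.right h.right_mem
  filter_upwards [(hPI S).resp_left_eq_sum h hM hN hMop hb hNop x,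
    Filter.eventually_all.2 fun i => C.resp_right_eq_born hAI hPI h hN hNop (b i)] with l h1 h2
  rw [h1, hMop, h.born_eigProj_left]
  refine Finset.sum_congr rfl fun i _ => (h2 i).trans ?_
  rw [hNop, h.born_eigProj_right]
  simp [hb.eq_iff, Finset.filter_eq']

lemma OnticModel.joint_eq_zero (O : OnticModel.{u, v} (Q S)) (P : (Q S).Prep)
    {M N : (Q S).Meas} (hMN : (Q S).SepLocal M N) (x y : ℝ)
    (h0 : born ((Q S).state P) (eigProj ((Q S).op M) x * eigProj ((Q S).op N) y) = 0) :
    ∀ᵐ l ∂(O.μ P), (O.joint M N l).real {(x, y)} = 0 := by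
  have := O.μ_prob P
  have h := (integral_eq_zero_iff_of_nonneg
    (fun l => (measureReal_nonneg : 0 ≤ (O.joint M N l).real {(x, y)}))
    (O.integrable_joint (O.μ P) hMN (x, y))).1 (by rw [O.joint_born P M N hMN, h0])
  filter_upwards [h] with l hl using hl

/-- A joint probability that agrees on average with the larger response probability `f` of one side
is almost surely equal to it. -/
lemma OnticModel.joint_eq_of_le (O : OnticModel.{u, v} (Q S)) (P : (Q S).Prep)
    {M N : (Q S).Meas} (hMN : (Q S).SepLocal M N) (x y : ℝ) {f : O.Λ → ℝ}
    (hf : Integrable f (O.μ P)) (hle : ∀ l, (O.joint M N l).real {(x, y)} ≤ f l)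
    (hfi : ∫ l, f l ∂(O.μ P) =
      born ((Q S).state P) (eigProj ((Q S).op M) x * eigProj ((Q S).op N) y)) :
    (fun l => (O.joint M N l).real {(x, y)}) =ᵐ[O.μ P] f := by
  have := O.μ_prob P
  have hi := O.integrable_joint (O.μ P) hMN (x, y)
  refine ae_eq_of_integral_abs_sub_nonpos hi hf (le_of_eq ?_)
  simp_rw [abs_sub_comm _ (f _), fun l => abs_of_nonneg (sub_nonneg.2 (hle l))]
  rw [integral_sub hf hi, hfi, O.joint_born P M N hMN, sub_self]

/-- Where a pair of values occurs at a common index, non-degeneracy of one side makes the other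
outcome a consequence of its own, so the joint probability has the average of that side's marginal.
All other pairs have Born probability zero. -/
lemma CompleteOnticModel.joint_eq_born (hAI : C.AncillaIndependent)
    (hPI : C.ParameterIndependent) (h : IsSchmidt S J ((Q S).state P) E F γ)
    {M N : (Q S).Meas} (hM : M ∈ (Q S).loc J) (hN : N ∈ (Q S).loc Jᶜ) {a b : ι → ℝ}
    (hMop : (Q S).op M = ∑ i, (a i : ℂ) • E i i) (hNop : (Q S).op N = ∑ i, (b i : ℂ) • F i i)
    (hab : Function.Injective a ∨ Function.Injective b) (x y : ℝ) :
    ∀ᵐ l ∂((C.model S).μ P), ((C.model S).joint M N l).real {(x, y)} =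
      born ((Q S).state P) (eigProj ((Q S).op M) x * eigProj ((Q S).op N) y) := by
  set O := C.model S
  have hO : O.ParameterIndependent := hPI S
  have := O.μ_prob P
  have hMN : (Q S).SepLocal M N := ⟨J, hM, hN⟩
  by_cases hi : ∃ i, a i = x ∧ b i = y
  · obtain ⟨i, rfl, rfl⟩ := hi
    rcases hab with ha | hb
    · have e : born ((Q S).state P) (eigProj ((Q S).op M) (a i)) =
          born ((Q S).state P) (eigProj ((Q S).op M) (a i) * eigProj ((Q S).op N) (b i)) := by
        rw [hMop, hNop, h.born_eigProj_left, h.born_eigProj_mul_eigProj]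
        refine Finset.sum_congr (Finset.filter_congr fun k _ => ?_) fun _ _ => rfl
        rw [ha.eq_iff]
        exact ⟨fun hk => ⟨hk, hk ▸ rfl⟩, fun hk => hk.1⟩
      filter_upwards [C.resp_left_eq_born hAI hPI h hM hMop (a i),
        O.joint_eq_of_le P hMN (a i) (b i) (O.integrable_resp _ M (a i))
          (fun l => by simpa using hO.sum_joint_le_left hM hN l (a i) {b i})
          ((O.resp_born P M (a i)).trans e)] with l h1 h2
      rw [h2, h1, e]
    · have e : born ((Q S).state P) (eigProj ((Q S).op N) (b i)) =
          born ((Q S).state P) (eigProj ((Q S).op M) (a i) * eigProj ((Q S).op N) (b i)) := by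
        rw [hMop, hNop, h.born_eigProj_right, h.born_eigProj_mul_eigProj]
        refine Finset.sum_congr (Finset.filter_congr fun k _ => ?_) fun _ _ => rfl
        rw [hb.eq_iff]
        exact ⟨fun hk => ⟨hk ▸ rfl, hk⟩, fun hk => hk.2⟩
      filter_upwards [C.resp_right_eq_born hAI hPI h hN hNop (b i),
        O.joint_eq_of_le P hMN (a i) (b i) (O.integrable_resp _ N (b i))
          (fun l => by simpa using hO.sum_joint_le_right hM hN l (b i) {a i})
          ((O.resp_born P N (b i)).trans e)] with l h1 h2
      rw [h2, h1, e]
  · have e : born ((Q S).state P) (eigProj ((Q S).op M) x * eigProj ((Q S).op N) y) = 0 := by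
      rw [hMop, hNop, h.born_eigProj_mul_eigProj, Finset.sum_filter]
      exact Finset.sum_eq_zero fun i _ => if_neg fun hxy => hi ⟨i, hxy⟩
    rw [e]
    exact O.joint_eq_zero P hMN x y e

lemma embed_diagOp {L : Finset S.parts} {d : ℕ}
    (e : OrthonormalBasis (Fin d) ℂ (EuclideanSpace ℂ (S.SubIdx L))) (a : Fin d → ℝ) :
    S.embed L (diagOp e a) = ∑ i, (a i : ℂ) • S.embed L (ketBra e i i) := by
  change S.embedHom L (∑ i, (a i : ℂ) • ketBra e i i) = _
  rw [map_sum]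
  exact Finset.sum_congr rfl fun i _ => map_smul (S.embedHom L) _ _

end Triviality

end Ontic

theorem theorem2
    (Q : ∀ S : Ontic.QSys, Ontic.Procedures S)
    (C : Ontic.CompleteOnticModel Q)
    (hAI : C.AncillaIndependent)
    (hPI : C.ParameterIndependent)
    (S : Ontic.QSys) (J : Finset S.parts) (d : ℕ) (hd : 2 ≤ d)
    (ψ : EuclideanSpace ℂ S.Idx) (hψ : ‖ψ‖ = 1)
    (e : OrthonormalBasis (Fin d) ℂ (EuclideanSpace ℂ (S.SubIdx J)))
    (f : OrthonormalBasis (Fin d) ℂ (EuclideanSpace ℂ (S.SubIdx Jᶜ)))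
    (c : Fin d → ℂ)
    (hSchmidt : ψ = ∑ i, c i • S.prodVec J (e i) (f i)) :
    (C.model S).IsTrivial ((Q S).locDiag J e ∪ (Q S).locDiag Jᶜ f) ((Q S).prepsOf ψ) ∧
    (C.model S).IsJointlyTrivial
      ((Q S).locDiagComplete J e ×ˢ (Q S).locDiag Jᶜ f ∪
        (Q S).locDiag J e ×ˢ (Q S).locDiagComplete Jᶜ f)
      ((Q S).prepsOf ψ) := by
  obtain ⟨u, hu, hc⟩ : ∃ u : Fin d → ℂ, (∀ i, star (u i) * u i = 1) ∧
      ∀ i, c i = (‖c i‖ : ℂ) * u i := by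
    -- The phases of the coefficients; where c i = 0 the convention arg 0 = 0 gives the phase 1, so
    -- `u` is unimodular everywhere.
    refine ⟨fun i => Complex.exp (Complex.arg (c i) * Complex.I), fun i => ?_, fun i =>
      (Complex.norm_mul_exp_arg_mul_I (c i)).symm⟩
    rw [RCLike.star_def, ← Complex.normSq_eq_conj_mul_self, Complex.normSq_eq_norm_sq,
      Complex.norm_exp_ofReal_mul_I]
    norm_num
  have hs := Ontic.isSchmidt_of_basis e f (fun i => norm_nonneg (c i)) hu hc
  rw [← hSchmidt] at hs
  have hE {M : (Q S).Meas} {a : Fin d → ℝ} (h : (Q S).op M = S.embed J (Ontic.diagOp e a)) :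
      (Q S).op M = ∑ i, (a i : ℂ) • S.embed J (Ontic.ketBra e i i) :=
    h.trans (Ontic.embed_diagOp e a)
  have hF {N : (Q S).Meas} {b : Fin d → ℝ} (h : (Q S).op N = S.embed Jᶜ (Ontic.diagOp f b)) :
      (Q S).op N =
        ∑ i, (b i : ℂ) • ((u i * star (u i)) • S.embed Jᶜ (Ontic.ketBra f i i)) := by
    rw [h, Ontic.embed_diagOp]
    refine Finset.sum_congr rfl fun i _ => ?_
    -- The phases cancel on the diagonal, so the measurements on the second side are still diagonal
    -- in the twisted matrix units.
    rw [mul_comm (u i), hu, one_smul]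
  refine ⟨fun P hP M hM x => ?_, fun P hP MN hMN x y => ?_⟩
  · rw [← show (Q S).state P = Ontic.pureState ψ from hP] at hs
    rcases hM with ⟨hM, a, ha⟩ | ⟨hM, b, hb⟩
    · exact C.resp_left_eq_born hAI hPI hs hM (hE ha) x
    · exact C.resp_right_eq_born hAI hPI hs hM (hF hb) x
  · rw [← show (Q S).state P = Ontic.pureState ψ from hP] at hs
    rcases hMN with ⟨⟨hM, a, hinj, ha⟩, hN, b, hb⟩ | ⟨⟨hM, a, ha⟩, hN, b, hinj, hb⟩
    · exact C.joint_eq_born hAI hPI hs hM hN (hE ha) (hF hb) (Or.inl hinj) x y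
    · exact C.joint_eq_born hAI hPI hs hM hN (hE ha) (hF hb) (Or.inr hinj) x y
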